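/- **Setting.** Polytropic gas: $p(\rho)=\frac{\rho_0c_0^2}{\gamma}(\rho/\rho_0)^\gamma$, $\gamma>1$, $\rho_0,c_0>0$, sound speed $c(\rho)$ with $c^2=dp/d\rho$, and $\pi(\rho)=\frac{c_0^2}{\gamma-1}\big((\rho/\rho_0)^{\gamma-1}-1\big)$. Self-similar potential flow in the variables $\vec\xi=\vec x/t\in\mathbb R^2$: a potential $\psi$, velocity $\vec v=\nabla\psi$, pseudo-potential $\chi=\psi-\frac12|\vec\xi|^2$, pseudo-velocity $\vec z=\nabla\chi=\vec v-\vec\xi$, density $\rho>0$ with $\pi(\rho)=-\chi-\frac12|\nabla\chi|^2$, and $\nabla\cdot(\rho\nabla\chi)+2\rho=0$ in the weak sense; the pseudo-Mach number is $L=|\vec z|/c$. At a shock, with $\vec n$ the unit normal towards the downstream side, $\psi$ and the tangential component of $\vec z$ are continuous, $\rho_uz_u^n=\rho_dz_d^n$, $z_u^n>0$ and $z_d^n\le z_u^n$. On walls $\vec v\cdot\vec n=0$. Let $0<\theta<\pi$ and $0<\alpha+\theta<\pi$. The fluid fills the sector $W=\{r(\cos\varphi,\sin\varphi):r>0,\ \theta<\varphi<\pi\}$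 between the reflection wall (direction $\theta$) and the opposite wall (direction $\pi$). The incident shock is the ray that starts in the reflection point $\vec\xi_R=r(\cos\theta,\sin\theta)$, $r>0$, in direction $\pi-\alpha$; it has positive strength and separates two constant states: upstream the 1-sector state $\rho_1>0,\vec v_1$ with $\vec v_1-\vec\xi_R=-M_1c(\rho_1)(\cos\theta,\sin\theta)$, and downstream the 2-sector state $\rho_2>0,\vec v_2$ with $\vec v_2$ parallel to the opposite wall. A *local regular reflection* is a shock of positive strength that leaves $\vec\xi_R$ in a direction $\omega\in(\pi-\alpha,\pi+\theta)$, with upstream state $\rho_2,\vec v_2$ and a downstream state $\rho_3,\vec v_3$ with $\vec v_3$ parallel to the reflection wall. If there are two of them, the one with smaller $|\vec v_3-\vec\xi_R|$ is called strong-type, the other one weak-type. It is transonic if $|\vec v_3-\vec\xi_R|<c(\rho_3)$. The *angle condition* says that the tangent of the strong-type reflected shock at $\vec\xi_R$ forms an angle $\le 90^\circ$ with the opposite wall on the downstream side. A *transonic global regular reflection* consists of the incident shock, extending to infinity inside $W$, and a reflected shock $S$ that is a simple regular curve, $C^1$ including its endpoints, from $\vec\xi_R$ to a point $\vec\xi_A\neq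 0$ on the opposite wall, which it meets in a right angle; between its endpoints $S$ lies in $W$ on the downstream side of the incident shock. The 3-sector $\Omega$ is the bounded region enclosed by $S$ and the wall segments $[0,\vec\xi_R]$ and $[0,\vec\xi_A]$; $S$ separates it from the 2-sector. In $\Omega$ there is a solution of self-similar potential flow with $\psi,\vec v,\rho$ continuous on $\overline\Omega$, $\rho>0$ on $\overline\Omega$, and $L<1$ in $\Omega$, which satisfies the slip condition on both wall segments and, with upstream state $\rho_2,\vec v_2$, the shock conditions on $S$. **Theorem.** Suppose that for the parameters $(M_1,\alpha,\theta)$ a local weak-type transonic regular reflection exists, but the angle condition is violated, i.e. the tangent of the strong-type reflected shock at the reflection point meets the opposite wall at an obtuse downstream angle. Then no transonic global regular reflection exists, neither with the weak-type nor with the strong-type reflected shock at the reflection point. -/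

import Mathlib

noncomputable section

namespace RegularReflection

/-- The plane of similarity coordinates (and of velocities), with its Euclidean norm. -/
abbrev Plane : Type := EuclideanSpace ℝ (Fin 2)

/-- The unit vector at counterclockwise angle `ω` from the positive first coordinate axis. -/
def dir (ω : ℝ) : Plane := !₂[Real.cos ω, Real.sin ω]

/-- Counterclockwise rotation by a right angle. -/
def rot90 (x : Plane) : Plane := !₂[-x 1, x 0]

/-- A polytropic gas with ratio of heats `γ ∈ (1,∞)` and reference density and sound speed, i.e.
with equation of state `p(ρ) = (ρ₀ c₀² / γ) (ρ / ρ₀) ^ γ`. -/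
structure Gas where
  γ : ℝ
  ρ₀ : ℝ
  c₀ : ℝ
  one_lt_γ : 1 < γ
  ρ₀_pos : 0 < ρ₀
  c₀_pos : 0 < c₀

/-- The sound speed `c(ρ)`, so that `c² = dp/dρ = c₀² (ρ / ρ₀) ^ (γ - 1)`. -/
def Gas.soundSpeed (G : Gas) (ρ : ℝ) : ℝ :=
  G.c₀ * (ρ / G.ρ₀) ^ ((G.γ - 1) / 2)

/-- The function `π(ρ)` with `dπ/dρ = c² / ρ` and `π(ρ₀) = 0`. It is strictly increasing for
`ρ > 0`, and `c² = c₀² + (γ - 1) π(ρ)`. -/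
def Gas.enthalpy (G : Gas) (ρ : ℝ) : ℝ :=
  G.c₀ ^ 2 / (G.γ - 1) * ((ρ / G.ρ₀) ^ (G.γ - 1) - 1)

/-- The pseudo-Mach number `L = |z| / c` at density `ρ` and pseudo-velocity `z = v - ξ`. -/
def Gas.pseudoMach (G : Gas) (ρ : ℝ) (z : Plane) : ℝ :=
  ‖z‖ / G.soundSpeed ρ

/-- The velocity potential of the constant state with density `ρ` and velocity `v`: the function
`ψ` with `∇ψ = v` and `π(ρ) = -χ - |∇χ|² / 2`, where `χ = ψ - |ξ|² / 2`. -/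
def Gas.constPotential (G : Gas) (ρ : ℝ) (v ξ : Plane) : ℝ :=
  inner ℝ v ξ - ‖v‖ ^ 2 / 2 - G.enthalpy ρ

/-- Shock conditions at one point of a shock, with `n` a positive multiple of the unit normal that
points to the downstream side, and with upstream and downstream densities and pseudo-velocities:
conservation of mass, continuity of the tangential component, the jump relation of `π(ρ)` that
expresses continuity of the potential, and admissibility. -/
structure Gas.IsShock (G : Gas) (n : Plane) (ρu : ℝ) (zu : Plane) (ρd : ℝ) (zd : Plane) :
    Prop where
  mass : ρu * inner ℝ zu n = ρd * inner ℝ zd n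
  tangential : inner ℝ zu (rot90 n) = inner ℝ zd (rot90 n)
  bernoulli : G.enthalpy ρu + ‖zu‖ ^ 2 / 2 = G.enthalpy ρd + ‖zd‖ ^ 2 / 2
  normal_pos : 0 < inner ℝ zu n
  admissible : inner ℝ zd n ≤ inner ℝ zu n

/-- Outer unit normal of the reflection wall, the ray from the origin (the corner of the two walls)
in direction `dir θ`. -/
def reflectionWallNormal (θ : ℝ) : Plane := !₂[Real.sin θ, -Real.cos θ]

/-- The fluid domain: the open sector between the reflection wall (direction `dir θ`) and the
opposite wall (the negative first coordinate axis). Its opening angle is `π - θ`. -/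
def fluidDomain (θ : ℝ) : Set Plane :=
  {ξ | 0 < ξ 1 ∧ inner ℝ ξ (reflectionWallNormal θ) < 0}

/-- The incident shock and the constant states on its sides, for the problem with parameters
`M₁`, `α`, `θ` and with density `ρ₁` in the 1-sector. The incident shock is the ray that leaves the
reflection point `r • dir θ` in direction `dir (π - α)`, so `α` is the counterclockwise angle from
the incident shock to the opposite wall. In the frame of the reflection point the 1-sector fluid
flows along the reflection wall towards the corner with Mach number `M₁`. -/
structure Incident (G : Gas) (ρ₁ M₁ α θ : ℝ) where
  /-- distance of the reflection point from the corner -/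
  r : ℝ
  r_pos : 0 < r
  /-- density in the 2-sector -/
  ρ₂ : ℝ
  ρ₂_pos : 0 < ρ₂
  /-- velocity in the 1-sector -/
  v₁ : Plane
  /-- velocity in the 2-sector -/
  v₂ : Plane
  mach : v₁ - r • dir θ = -(M₁ * G.soundSpeed ρ₁) • dir θ
  shock : G.IsShock (rot90 (dir (Real.pi - α))) ρ₁ (v₁ - r • dir θ) ρ₂ (v₂ - r • dir θ)
  jump : v₂ ≠ v₁
  /-- slip condition for the 2-sector fluid at the opposite wall -/
  slip : v₂ 1 = 0

namespace Incident

variable {G : Gas} {ρ₁ M₁ α θ : ℝ} (I : Incident G ρ₁ M₁ α θ)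

/-- The reflection point. -/
def reflectionPoint : Plane := I.r • dir θ

/-- Local regular reflection: a reflected shock that leaves the reflection point in direction
`dir ω`, strictly between the incident shock and the part of the reflection wall that leads to the
corner, with upstream state `ρ₂, v₂`, and with a downstream state `ρ₃, v₃` that satisfies the slip
condition at the reflection wall. -/
structure IsLocalRR (ω ρ₃ : ℝ) (v₃ : Plane) : Prop where
  between : ω ∈ Set.Ioo (Real.pi - α) (Real.pi + θ)
  density_pos : 0 < ρ₃
  shock : G.IsShock (rot90 (dir ω)) I.ρ₂ (I.v₂ - I.reflectionPoint) ρ₃ (v₃ - I.reflectionPoint)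
  jump : v₃ ≠ I.v₂
  slip : inner ℝ v₃ (reflectionWallNormal θ) = 0

/-- Strong-type local regular reflection: of the two reflected shocks, the one with smaller
downstream speed in the frame of the reflection point. -/
def IsStrongType (ω ρ₃ : ℝ) (v₃ : Plane) : Prop :=
  I.IsLocalRR ω ρ₃ v₃ ∧ ∃ ω' ρ' v', I.IsLocalRR ω' ρ' v' ∧
    ‖v₃ - I.reflectionPoint‖ < ‖v' - I.reflectionPoint‖

/-- Weak-type local regular reflection: of the two reflected shocks, the one with larger
downstream speed in the frame of the reflection point. -/
def IsWeakType (ω ρ₃ : ℝ) (v₃ : Plane) : Prop :=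
  I.IsLocalRR ω ρ₃ v₃ ∧ ∃ ω' ρ' v', I.IsLocalRR ω' ρ' v' ∧
    ‖v' - I.reflectionPoint‖ < ‖v₃ - I.reflectionPoint‖

/-- A local weak-type regular reflection exists and is transonic: its downstream flow is subsonic in
the frame of the reflection point. -/
def HasTransonicWeakRR : Prop :=
  ∃ ω ρ₃ v₃, I.IsWeakType ω ρ₃ v₃ ∧ G.pseudoMach ρ₃ (v₃ - I.reflectionPoint) < 1

/-- The angle condition: the tangent of the strong-type reflected shock, which reaches the opposite
wall from above, forms there an angle of at most a right angle with the opposite wall on its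
downstream side, i.e. the side of the corner (direction `dir 0` along the opposite wall). -/
def AngleCondition : Prop :=
  ∀ ω ρ₃ v₃, I.IsStrongType ω ρ₃ v₃ →
    InnerProductGeometry.angle (-dir ω) (dir 0) ≤ Real.pi / 2

/-- Transonic global regular reflection with the given incident shock. The state is `ρ₁, v₁` in the
1-sector, the part of the fluid domain on the upstream side of the incident shock. The reflected
shock is the curve `s` on `[0,1]`, the 3-sector is `Ω`, with potential `ψ`, velocity `v = ∇ψ` and
density `ρ`. The remaining part of the fluid domain is the 2-sector, with the state `ρ₂, v₂`. Nothing
is required about the type, weak or strong, of the reflected shock at the reflection point. -/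
structure GlobalRR where
  /-- the incident shock extends to infinity inside the fluid domain -/
  incident_mem : ∀ t : ℝ, 0 < t → I.reflectionPoint + t • dir (Real.pi - α) ∈ fluidDomain θ
  /-- the reflected shock -/
  s : ℝ → Plane
  /-- its tangent -/
  s' : ℝ → Plane
  /-- distance from the corner of the point where the reflected shock meets the opposite wall -/
  a : ℝ
  a_pos : 0 < a
  s_zero : s 0 = I.reflectionPoint
  s_one : s 1 = -a • dir 0
  -- the reflected shock is a simple regular curve, continuously differentiable up to its endpoints
  s_deriv : ∀ t ∈ Set.Icc (0 : ℝ) 1, HasDerivWithinAt s (s' t) (Set.Icc 0 1) t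
  s'_cont : ContinuousOn s' (Set.Icc 0 1)
  s'_ne_zero : ∀ t ∈ Set.Icc (0 : ℝ) 1, s' t ≠ 0
  s_inj : Set.InjOn s (Set.Icc 0 1)
  /-- between its endpoints it lies in the fluid domain, downstream of the incident shock -/
  s_mem : ∀ t ∈ Set.Ioo (0 : ℝ) 1, s t ∈ fluidDomain θ ∧
    0 < inner ℝ (s t - I.reflectionPoint) (rot90 (dir (Real.pi - α)))
  /-- it meets the opposite wall in a right angle -/
  right_angle : inner ℝ (s' 1) (dir 0) = 0
  /-- the interior of the 3-sector -/
  Ω : Set Plane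
  -- `Ω` is the region enclosed by the reflected shock, the reflection wall and the opposite wall
  Ω_open : IsOpen Ω
  Ω_conn : IsConnected Ω
  Ω_bdd : Bornology.IsBounded Ω
  Ω_sub : Ω ⊆ fluidDomain θ
  Ω_frontier : frontier Ω =
    s '' Set.Icc 0 1 ∪ segment ℝ 0 I.reflectionPoint ∪ segment ℝ 0 (s 1)
  /-- the reflected shock separates the 3-sector, on the side of the normal `rot90 (s' t)`, from
  the 2-sector on the other side -/
  Ω_side : ∀ t ∈ Set.Ioo (0 : ℝ) 1, ∀ᶠ ε in nhdsWithin (0 : ℝ) (Set.Ioi 0),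
    s t + ε • rot90 (s' t) ∈ Ω ∧ s t - ε • rot90 (s' t) ∉ closure Ω
  /-- the velocity potential in the 3-sector -/
  ψ : Plane → ℝ
  /-- the velocity in the 3-sector -/
  v : Plane → Plane
  /-- the density in the 3-sector -/
  ρ : Plane → ℝ
  -- the fluid variables are continuous up to the boundary of the 3-sector
  ψ_cont : ContinuousOn ψ (closure Ω)
  v_cont : ContinuousOn v (closure Ω)
  ρ_cont : ContinuousOn ρ (closure Ω)
  ψ_grad : ∀ ξ ∈ Ω, HasGradientAt ψ (v ξ) ξ
  ρ_pos : ∀ ξ ∈ closure Ω, 0 < ρ ξ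
  /-- `π(ρ) = -χ - |∇χ|² / 2` with `χ = ψ - |ξ|² / 2` -/
  bernoulli : ∀ ξ ∈ closure Ω,
    G.enthalpy (ρ ξ) = -(ψ ξ - ‖ξ‖ ^ 2 / 2) - ‖v ξ - ξ‖ ^ 2 / 2
  /-- self-similar potential flow `∇ · (ρ∇χ) + 2ρ = 0` in the weak sense (the flux is continuous, so
  once or infinitely often differentiable test functions give the same condition) -/
  weak_eq : ∀ φ : Plane → ℝ, ContDiff ℝ 1 φ → HasCompactSupport φ → tsupport φ ⊆ Ω →
    ∫ ξ in Ω, (ρ ξ * inner ℝ (v ξ - ξ) (gradient φ ξ) - 2 * ρ ξ * φ ξ) = 0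
  /-- the flow is elliptic in the interior of the 3-sector -/
  elliptic : ∀ ξ ∈ Ω, G.pseudoMach (ρ ξ) (v ξ - ξ) < 1
  slip_opposite : ∀ ξ ∈ segment ℝ 0 (s 1), v ξ 1 = 0
  slip_reflection : ∀ ξ ∈ segment ℝ 0 I.reflectionPoint,
    inner ℝ (v ξ) (reflectionWallNormal θ) = 0
  /-- the potential is continuous across the reflected shock -/
  ψ_shock : ∀ t ∈ Set.Icc (0 : ℝ) 1, ψ (s t) = G.constPotential I.ρ₂ I.v₂ (s t)
  /-- shock conditions at the reflected shock -/
  shock : ∀ t ∈ Set.Icc (0 : ℝ) 1,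
    G.IsShock (rot90 (s' t)) I.ρ₂ (I.v₂ - s t) (ρ (s t)) (v (s t) - s t)

end Incident

end RegularReflection

end

/-! ### The gas law and log-concavity of the mass flux -/

noncomputable section

namespace RegularReflection

/-! The opposite wall is horizontal, so `I.v₂` is `(u, 0)`. The contradiction comes from the point
of the closed 3-sector where `ψ` is maximal, compared with fluid at rest at the reflection point.

Local analysis (`Incident.of_not_angleCondition`). With downstream velocity along the reflection
wall, a reflected shock is determined by its downstream speed `q` towards the corner, in the frame
of the reflection point. Mass balance becomes one equation in `q`, and the logarithm of the ratio of
its sides is strictly concave. Its roots are therefore the strong-type `q` and the weak-type `q'`,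
and below `q` the balance has a strict sign (`Gas.polar_lt`). An obtuse angle gives `0 < u`, `cos θ
< 0` and `r < q`. Hence every admissible state at the reflection point moves towards the corner, and
the strict sign holds at speed `r`, which is fluid at rest: behind a vertical shock at the
reflection point its mass flux would be too small.

Global analysis. By a maximum principle (`Gas.exists_frontier_ge`) and the slip conditions, `ψ`
attains its maximum on the shock (`exists_max`). There `ψ` equals `u` times the first coordinate
plus a constant, so the maximum is at a rightmost shock point. It is not the reflection point,
because the velocity there points along the wall into the 3-sector, so that `ψ` increases. At any
other shock point the shock is vertical, by the first-order condition or by the right angle at the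
opposite wall, and the downstream horizontal velocity is nonpositive. Log-concavity of the flux then
gives stagnant fluid at least the upstream mass flux at that point, and by monotonicity also at the
reflection point, which lies no further right (`Gas.stagnation_flux_le`). This contradicts the local
inequality. -/

theorem inner_eq (x y : Plane) : inner ℝ x y = x 0 * y 0 + x 1 * y 1 := by
  simp [PiLp.inner_apply, Fin.sum_univ_two, mul_comm]

theorem norm_sq_eq (x : Plane) : ‖x‖ ^ 2 = x 0 ^ 2 + x 1 ^ 2 := by
  rw [← real_inner_self_eq_norm_sq, inner_eq]; ring

theorem plane_ext {x y : Plane} (h0 : x 0 = y 0) (h1 : x 1 = y 1) : x = y := by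
  ext i; fin_cases i <;> simpa

@[simp] theorem dir_zero (ω : ℝ) : dir ω 0 = Real.cos ω := rfl
@[simp] theorem dir_one (ω : ℝ) : dir ω 1 = Real.sin ω := rfl
@[simp] theorem rot90_zero (x : Plane) : rot90 x 0 = -x 1 := rfl
@[simp] theorem rot90_one (x : Plane) : rot90 x 1 = x 0 := rfl
@[simp] theorem reflectionWallNormal_zero (θ : ℝ) : reflectionWallNormal θ 0 = Real.sin θ := rfl
@[simp] theorem reflectionWallNormal_one (θ : ℝ) : reflectionWallNormal θ 1 = -Real.cos θ := rfl

/-- The density as a function of `π`, i.e. the inverse function of `π(ρ)`. -/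
def Gas.density (G : Gas) (h : ℝ) : ℝ :=
  G.ρ₀ * (1 + (G.γ - 1) / G.c₀ ^ 2 * h) ^ (1 / (G.γ - 1))

namespace Gas

variable (G : Gas)

theorem γ_sub_one_pos : 0 < G.γ - 1 := sub_pos.2 G.one_lt_γ

theorem base_enthalpy (ρ : ℝ) :
    1 + (G.γ - 1) / G.c₀ ^ 2 * G.enthalpy ρ = (ρ / G.ρ₀) ^ (G.γ - 1) := by
  have h1 := G.γ_sub_one_pos.ne'
  have h2 := G.c₀_pos.ne'
  unfold enthalpy
  field_simp
  ring

theorem base_enthalpy_pos {ρ : ℝ} (hρ : 0 < ρ) :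
    0 < 1 + (G.γ - 1) / G.c₀ ^ 2 * G.enthalpy ρ := by
  rw [base_enthalpy]
  exact Real.rpow_pos_of_pos (div_pos hρ G.ρ₀_pos) _

theorem density_enthalpy {ρ : ℝ} (hρ : 0 < ρ) : G.density (G.enthalpy ρ) = ρ := by
  have h := (div_pos hρ G.ρ₀_pos).le
  rw [density, base_enthalpy, ← Real.rpow_mul h, mul_one_div_cancel G.γ_sub_one_pos.ne',
    Real.rpow_one, mul_div_cancel₀ _ G.ρ₀_pos.ne']

theorem continuous_density : Continuous G.density := by
  unfold density
  have h : 0 ≤ 1 / (G.γ - 1) := (one_div_pos.2 G.γ_sub_one_pos).le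
  exact continuous_const.mul ((by fun_prop : Continuous fun h : ℝ =>
    1 + (G.γ - 1) / G.c₀ ^ 2 * h).rpow_const fun _ => Or.inr h)

theorem density_pos {h : ℝ} (hh : 0 < 1 + (G.γ - 1) / G.c₀ ^ 2 * h) : 0 < G.density h :=
  mul_pos G.ρ₀_pos (Real.rpow_pos_of_pos hh _)

theorem coeff_pos : 0 < (G.γ - 1) / G.c₀ ^ 2 :=
  div_pos G.γ_sub_one_pos (pow_pos G.c₀_pos 2)

theorem density_le_density {h k : ℝ} (hh : 0 ≤ 1 + (G.γ - 1) / G.c₀ ^ 2 * h) (hk : h ≤ k) :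
    G.density h ≤ G.density k := by
  unfold density
  have := G.coeff_pos
  have h1 := G.ρ₀_pos
  have : (G.γ - 1) / G.c₀ ^ 2 * h ≤ (G.γ - 1) / G.c₀ ^ 2 * k := by gcongr
  have h2 : 0 ≤ 1 / (G.γ - 1) := (one_div_pos.2 G.γ_sub_one_pos).le
  exact mul_le_mul_of_nonneg_left (Real.rpow_le_rpow hh (by linarith) h2) h1.le

theorem soundSpeed_pos {ρ : ℝ} (hρ : 0 < ρ) : 0 < G.soundSpeed ρ :=
  mul_pos G.c₀_pos (Real.rpow_pos_of_pos (div_pos hρ G.ρ₀_pos) _)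

theorem soundSpeed_sq {ρ : ℝ} (hρ : 0 < ρ) :
    G.soundSpeed ρ ^ 2 = G.c₀ ^ 2 * (ρ / G.ρ₀) ^ (G.γ - 1) := by
  rw [soundSpeed, mul_pow, ← Real.rpow_natCast, ← Real.rpow_natCast _ 2,
    ← Real.rpow_mul (div_pos hρ G.ρ₀_pos).le]
  norm_num

theorem hasStrictDerivAt_density {ρ : ℝ} (hρ : 0 < ρ) :
    HasStrictDerivAt G.density (ρ / G.soundSpeed ρ ^ 2) (G.enthalpy ρ) := by
  have hb := G.base_enthalpy_pos hρ
  have h1 : HasStrictDerivAt (fun h : ℝ => 1 + (G.γ - 1) / G.c₀ ^ 2 * h)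
      ((G.γ - 1) / G.c₀ ^ 2) (G.enthalpy ρ) := by
    simpa using ((hasStrictDerivAt_id (G.enthalpy ρ)).const_mul
      ((G.γ - 1) / G.c₀ ^ 2)).const_add 1
  have h2 := (HasStrictDerivAt.comp (h := fun h : ℝ => 1 + (G.γ - 1) / G.c₀ ^ 2 * h) _
    (Real.hasStrictDerivAt_rpow_const_of_ne hb.ne' (1 / (G.γ - 1))) h1).const_mul G.ρ₀
  refine h2.congr_deriv ?_
  have hd := G.density_enthalpy hρ
  unfold density at hd
  rw [Real.rpow_sub_one hb.ne', soundSpeed_sq G hρ, ← base_enthalpy]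
  have h3 := G.γ_sub_one_pos.ne'
  have h4 := G.c₀_pos.ne'
  set b := 1 + (G.γ - 1) / G.c₀ ^ 2 * G.enthalpy ρ
  rw [← hd]
  field_simp

end Gas

/-! ### Concavity along the shock polar -/

theorem concaveOn_log_comp {s : Set ℝ} {f : ℝ → ℝ} (hf : ConcaveOn ℝ s f)
    (hpos : ∀ x ∈ s, 0 < f x) : ConcaveOn ℝ s fun x => Real.log (f x) := by
  refine ⟨hf.1, fun x hx y hy a b ha hb hab => ?_⟩
  refine (strictConcaveOn_log_Ioi.concaveOn.2 (hpos x hx) (hpos y hy) ha hb hab).trans ?_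
  have h1 := hf.2 hx hy ha hb hab
  refine Real.log_le_log ?_ h1
  exact convex_Ioi (0 : ℝ) (hpos x hx) (hpos y hy) ha hb hab

/-- The speeds `q` at which a state with Bernoulli constant `A` exists. -/
def Gas.speeds (G : Gas) (A : ℝ) : Set ℝ :=
  {q | 0 < q ∧ 0 < 1 + (G.γ - 1) / G.c₀ ^ 2 * (A - q ^ 2 / 2)}

theorem Gas.speeds_ordConnected_left (G : Gas) {A q q' : ℝ} (hq : q ∈ G.speeds A) (h0 : 0 < q')
    (h : q' ≤ q) : q' ∈ G.speeds A := by
  refine ⟨h0, hq.2.trans_le ?_⟩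
  have := G.coeff_pos
  gcongr

theorem Gas.concaveOn_base (G : Gas) (A : ℝ) :
    ConcaveOn ℝ Set.univ fun q : ℝ => 1 + (G.γ - 1) / G.c₀ ^ 2 * (A - q ^ 2 / 2) := by
  have h := G.coeff_pos
  set k := (G.γ - 1) / G.c₀ ^ 2
  refine ⟨convex_univ, fun x _ y _ a b ha hb hab => ?_⟩
  obtain rfl : b = 1 - a := by linarith
  simp only [smul_eq_mul]
  nlinarith [mul_nonneg (mul_nonneg (mul_nonneg ha hb) h.le) (sq_nonneg (x - y))]

/-- The mass flux at fixed Bernoulli constant is a strictly log-concave function of the speed. -/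
theorem Gas.strictConcaveOn_log_flux (G : Gas) (A : ℝ) :
    StrictConcaveOn ℝ (G.speeds A) fun q => Real.log q + Real.log (G.density (A - q ^ 2 / 2)) := by
  have hconv : Convex ℝ (G.speeds A) := by
    have h := (convex_Ioi (0 : ℝ)).inter ((G.concaveOn_base A).convex_gt 0)
    have h2 : G.speeds A = Set.Ioi 0 ∩ {x | x ∈ Set.univ ∧
        0 < 1 + (G.γ - 1) / G.c₀ ^ 2 * (A - x ^ 2 / 2)} := by
      ext q; simp [Gas.speeds]
    rw [h2]; exact h
  refine (strictConcaveOn_log_Ioi.subset (fun q hq => hq.1) hconv).add_concaveOn ?_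
  have h1 := concaveOn_log_comp ((G.concaveOn_base A).subset (Set.subset_univ _) hconv)
    fun q hq => hq.2
  have h2 := (h1.smul (one_div_pos.2 G.γ_sub_one_pos).le).add_const (Real.log G.ρ₀)
  refine h2.congr fun q hq => ?_
  simp only [Gas.density, smul_eq_mul]
  rw [Real.log_mul G.ρ₀_pos.ne' (Real.rpow_pos_of_pos hq.2 _).ne', Real.log_rpow hq.2]
  simp [add_comm]

/-- The quotient equals `1 / a - (Q - a ^ 2) / (a * (Q - a * q))`, and the reciprocal of a positive
affine function is convex. It is the geometric factor in the mass balance on the polar, with `Q` the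
squared upstream speed and `a` its component along the wall. -/
theorem concaveOn_polar_factor {a Q : ℝ} (ha : 0 < a) (hQ : a ^ 2 ≤ Q) :
    ConcaveOn ℝ (Set.Iio a) fun q => Real.log ((a - q) / (Q - a * q)) := by
  refine concaveOn_log_comp ⟨convex_Iio a, fun x hx y hy s t hs ht hst => ?_⟩ fun q hq => ?_
  · simp only [smul_eq_mul, Set.mem_Iio] at *
    obtain rfl : t = 1 - s := by linarith
    have hX : 0 < Q - a * x := by nlinarith
    have hY : 0 < Q - a * y := by nlinarith
    have hxy : s * x + (1 - s) * y < a := convex_Iio a hx hy hs ht hst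
    have hZ : 0 < Q - a * (s * x + (1 - s) * y) := by nlinarith
    have key : (a - (s * x + (1 - s) * y)) / (Q - a * (s * x + (1 - s) * y)) -
        (s * ((a - x) / (Q - a * x)) + (1 - s) * ((a - y) / (Q - a * y))) =
        s * (1 - s) * (a * (Q - a ^ 2) * (x - y) ^ 2) /
          ((Q - a * (s * x + (1 - s) * y)) * (Q - a * x) * (Q - a * y)) := by
      field_simp
      ring
    have : 0 ≤ s * (1 - s) * (a * (Q - a ^ 2) * (x - y) ^ 2) /
          ((Q - a * (s * x + (1 - s) * y)) * (Q - a * x) * (Q - a * y)) := by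
      have := sub_nonneg.2 hQ
      positivity
    linarith
  · simp only [Set.mem_Iio] at hq
    have hX : 0 < Q - a * q := by nlinarith
    exact div_pos (by linarith) hX

theorem lt_of_strictConcaveOn_of_eq {s : Set ℝ} {f : ℝ → ℝ} (hf : StrictConcaveOn ℝ s f)
    {x y z : ℝ} (hx : x ∈ s) (hz : z ∈ s) (hxy : x < y) (hyz : y < z) (h : f y = f z) :
    f x < f y := by
  have := hf.slope_anti_adjacent hx hz hxy hyz
  rw [h, sub_self, zero_div] at this
  have h2 := (div_pos_iff_of_pos_right (sub_pos.2 hxy)).1 this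
  linarith

/-- On the shock polar, below the smaller of two speeds on a line through the pole the mass balance
has a definite sign. -/
theorem Gas.polar_lt (G : Gas) {A a Q ρu q q₁ q₂ : ℝ} (hQ : a ^ 2 ≤ Q) (hρu : 0 < ρu)
    (hq : 0 < q) (h1 : q < q₁) (h2 : q₁ < q₂) (h3 : q₂ < a) (hm : q₂ ∈ G.speeds A)
    (e1 : ρu * (Q - a * q₁) = G.density (A - q₁ ^ 2 / 2) * q₁ * (a - q₁))
    (e2 : ρu * (Q - a * q₂) = G.density (A - q₂ ^ 2 / 2) * q₂ * (a - q₂)) :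
    G.density (A - q ^ 2 / 2) * q * (a - q) < ρu * (Q - a * q) := by
  have ha : 0 < a := by linarith
  have hc := (G.strictConcaveOn_log_flux A).subset Set.inter_subset_left
    ((G.strictConcaveOn_log_flux A).1.inter (convex_Iio a))
  -- The sum is the logarithm of the ratio that mass balance sets equal to `ρu`; it takes the value
  -- `log ρu` at both `q₁` and `q₂`, so strict concavity puts it below this value to the left of
  -- `q₁`.
  have hc2 := hc.add_concaveOn
    ((concaveOn_polar_factor ha hQ).subset Set.inter_subset_right hc.1)
  have val : ∀ x ∈ G.speeds A ∩ Set.Iio a, ((fun q => Real.log q + Real.log (G.density (A - q ^ 2 / 2)))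
      + fun q => Real.log ((a - q) / (Q - a * q))) x =
      Real.log (G.density (A - x ^ 2 / 2) * x * (a - x) / (Q - a * x)) := by
    rintro x ⟨⟨hx0, hx1⟩, hx2⟩
    have hx2' : x < a := hx2
    have hX : 0 < Q - a * x := by nlinarith
    have := G.density_pos hx1
    have h5 : 0 < a - x := by linarith
    simp only [Pi.add_apply]
    rw [← Real.log_mul hx0.ne' this.ne', ← Real.log_mul (by positivity) (by positivity)]
    congr 1; ring
  have m1 := G.speeds_ordConnected_left hm (hq.trans h1) h2.le
  have m := G.speeds_ordConnected_left hm hq (h1.trans h2).le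
  have i : q ∈ G.speeds A ∩ Set.Iio a := ⟨m, by simp only [Set.mem_Iio]; linarith⟩
  have i1 : q₁ ∈ G.speeds A ∩ Set.Iio a := ⟨m1, by simp only [Set.mem_Iio]; linarith⟩
  have i2 : q₂ ∈ G.speeds A ∩ Set.Iio a := ⟨hm, h3⟩
  have p : ∀ x ∈ G.speeds A ∩ Set.Iio a, 0 < Q - a * x := fun x hx => by
    have : x < a := hx.2
    nlinarith
  have r1 := val q₁ i1
  have r2 := val q₂ i2
  rw [← e1, mul_div_cancel_right₀ _ (p _ i1).ne'] at r1
  rw [← e2, mul_div_cancel_right₀ _ (p _ i2).ne'] at r2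
  have := lt_of_strictConcaveOn_of_eq hc2 i i2 h1 h2 (r1.trans r2.symm)
  rw [r1, val q i] at this
  have hd := G.density_pos m.2
  have hP := p q i
  have h5 : 0 < a - q := by linarith
  rw [Real.log_lt_log_iff (by positivity) hρu, div_lt_iff₀ hP] at this
  exact this

/-- Between two speeds of equal mass flux the mass flux is at least as large. -/
theorem Gas.flux_le (G : Gas) {A p q r : ℝ} (hp : 0 < p) (hpq : p ≤ q) (hqr : q < r)
    (hr : r ∈ G.speeds A)
    (h : G.density (A - p ^ 2 / 2) * p = G.density (A - r ^ 2 / 2) * r) :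
    G.density (A - r ^ 2 / 2) * r ≤ G.density (A - q ^ 2 / 2) * q := by
  rcases hpq.eq_or_lt with rfl | hpq
  · exact h.ge
  have hc := G.strictConcaveOn_log_flux A
  have mq := G.speeds_ordConnected_left hr (hp.trans hpq) hqr.le
  have mp := G.speeds_ordConnected_left mq hp hpq.le
  have val : ∀ x ∈ G.speeds A, Real.log x + Real.log (G.density (A - x ^ 2 / 2)) =
      Real.log (G.density (A - x ^ 2 / 2) * x) := fun x hx => by
    rw [Real.log_mul (G.density_pos hx.2).ne' hx.1.ne', add_comm]
  have := hc.slope_anti_adjacent mp hr hpq hqr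
  simp only [val _ mp, val _ hr, val _ mq, h] at this
  by_contra! hlt
  have hl := Real.log_lt_log (mul_pos (G.density_pos mq.2) mq.1) hlt
  have a1 := div_pos (sub_pos.2 hl) (sub_pos.2 hqr)
  have a2 := div_neg_of_neg_of_pos (sub_neg.2 hl) (sub_pos.2 hpq)
  linarith

end RegularReflection

end

/-! ### Test functions and the pointwise energy estimate -/

noncomputable section

namespace RegularReflection

open Filter Topology MeasureTheory Set

theorem hasDerivAt_posPart_pow (m : ℝ) (n : ℕ) (s : ℝ) :
    HasDerivAt (fun s : ℝ => max (s - m) 0 ^ (n + 2)) ((n + 2) * max (s - m) 0 ^ (n + 1)) s := by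
  rcases lt_trichotomy s m with h | rfl | h
  · have h1 : (fun s : ℝ => max (s - m) 0 ^ (n + 2)) =ᶠ[𝓝 s] fun _ => 0 := by
      filter_upwards [gt_mem_nhds h] with t ht
      simp [max_eq_right (sub_nonpos.2 ht.le)]
    rw [max_eq_right (sub_nonpos.2 h.le)]
    simpa using (hasDerivAt_const s (0 : ℝ)).congr_of_eventuallyEq h1
  · have h1 : HasDerivAt (fun t : ℝ => max (t - s) 0 ^ (n + 2)) 0 s := by
      rw [hasDerivAt_iff_isLittleO]
      have : (fun t : ℝ => (t - s) ^ (n + 2)) =o[𝓝 s] fun t => t - s := by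
        have h2 : Tendsto (fun t : ℝ => t - s) (𝓝 s) (𝓝 0) := by
          have : Continuous fun t : ℝ => t - s := by fun_prop
          simpa using this.tendsto s
        exact (Asymptotics.isLittleO_pow_id (by omega : 1 < n + 2)).comp_tendsto h2
      refine Asymptotics.IsBigO.trans_isLittleO (Asymptotics.IsBigO.of_bound 1 ?_) this
      refine Eventually.of_forall fun t => ?_
      simp only [sub_self, max_self, smul_zero, sub_zero, norm_pow, one_mul, ne_eq,
        Nat.add_eq_zero_iff, OfNat.ofNat_ne_zero, and_false, not_false_eq_true, zero_pow]
      gcongr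
      rw [Real.norm_eq_abs, Real.norm_eq_abs, abs_of_nonneg (le_max_right _ _)]
      exact max_le (le_abs_self _) (abs_nonneg _)
    simpa using h1
  · have h1 : (fun s : ℝ => max (s - m) 0 ^ (n + 2)) =ᶠ[𝓝 s] fun s => (s - m) ^ (n + 2) := by
      filter_upwards [lt_mem_nhds h] with t ht
      rw [max_eq_left (sub_nonneg.2 ht.le)]
    rw [max_eq_left (sub_nonneg.2 h.le)]
    have h2 := ((hasDerivAt_id s).sub_const m).pow (n + 2)
    refine HasDerivAt.congr_of_eventuallyEq (h2.congr_deriv ?_) h1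
    simp

/-- The integrand is the divergence of `φ ξ • (ξ - w)` in two dimensions. These identities hold
without any flow equation and cancel the terms of indefinite sign in the energy estimate. -/
theorem integral_div_eq_zero {φ : Plane → ℝ} (hφ : ContDiff ℝ 1 φ) (hc : HasCompactSupport φ)
    (w : Plane) : ∫ ξ, (inner ℝ (ξ - w) (gradient φ ξ) + 2 * φ ξ) = 0 := by
  have hd : Differentiable ℝ φ := hφ.differentiable one_ne_zero
  have hcd : Continuous (fderiv ℝ φ) := hφ.continuous_fderiv one_ne_zero
  have hi : ∀ i : Fin 2, Integrable (fun ξ : Plane => (ξ i - w i) *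
        fderiv ℝ φ ξ (EuclideanSpace.single i 1)) := fun i => by
    refine Continuous.integrable_of_hasCompactSupport (by fun_prop) ?_
    refine ((hc.fderiv (𝕜 := ℝ)).comp_left (g := fun L : Plane →L[ℝ] ℝ =>
      L (EuclideanSpace.single i 1)) (by simp)).mul_left
  have hφi : Integrable φ := hφ.continuous.integrable_of_hasCompactSupport hc
  have key : ∀ i : Fin 2, ∫ ξ : Plane, (ξ i - w i) *
      fderiv ℝ φ ξ (EuclideanSpace.single i 1) = - ∫ ξ, φ ξ := fun i => by
    have hf : ∀ ξ : Plane, HasFDerivAt (fun ξ : Plane => ξ i - w i)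
        (EuclideanSpace.proj i : Plane →L[ℝ] ℝ) ξ := fun ξ =>
      ((EuclideanSpace.proj i : Plane →L[ℝ] ℝ).hasFDerivAt).sub_const _
    have h1 : ∀ ξ : Plane, fderiv ℝ (fun ξ : Plane => ξ i - w i) ξ (EuclideanSpace.single i 1)
        = 1 := fun ξ => by
      rw [(hf ξ).fderiv]; simp
    have := integral_mul_fderiv_eq_neg_fderiv_mul_of_integrable (μ := volume)
      (f := fun ξ : Plane => ξ i - w i) (g := φ) (v := EuclideanSpace.single i 1)
      (by simpa only [h1, one_mul] using hφi) (hi i)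
      (Continuous.integrable_of_hasCompactSupport (by fun_prop) hc.mul_left)
      (fun ξ _ => (hf ξ).differentiableAt) (fun ξ _ => hd ξ)
    simpa only [h1, one_mul] using this
  have e : ∀ ξ : Plane, inner ℝ (ξ - w) (gradient φ ξ) + 2 * φ ξ =
      (ξ 0 - w 0) * fderiv ℝ φ ξ (EuclideanSpace.single 0 1) +
      (ξ 1 - w 1) * fderiv ℝ φ ξ (EuclideanSpace.single 1 1) + 2 * φ ξ := fun ξ => by
    have h : ∀ i : Fin 2, fderiv ℝ φ ξ (EuclideanSpace.single i 1) = gradient φ ξ i := fun i => by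
      have := (hd ξ).hasGradientAt.hasFDerivAt.fderiv
      rw [this, InnerProductSpace.toDual_apply_apply, EuclideanSpace.inner_single_right]
      simp
    rw [h, h, inner_eq]; simp
  simp_rw [e]
  have h01 : Integrable fun ξ : Plane => (ξ 0 - w 0) * fderiv ℝ φ ξ (EuclideanSpace.single 0 1) +
      (ξ 1 - w 1) * fderiv ℝ φ ξ (EuclideanSpace.single 1 1) := (hi 0).add (hi 1)
  rw [integral_add h01 (hφi.const_mul 2), integral_add (hi 0) (hi 1), key, key,
    integral_const_mul]
  ring

/-- Functions of a function that is small near the frontier of a domain, extended by zero, are test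
functions. -/
theorem testFunction_comp {Ω : Set Plane} (hΩ : IsOpen Ω) (hb : Bornology.IsBounded Ω)
    {g : Plane → ℝ} {V : Plane → Plane} (hg : ContinuousOn g (closure Ω))
    (hV : ContinuousOn V Ω) (hgV : ∀ ξ ∈ Ω, HasGradientAt g (V ξ) ξ) {m : ℝ}
    (hm : ∀ ξ ∈ closure Ω, m ≤ g ξ → ξ ∈ Ω) {Φ Φ' : ℝ → ℝ}
    (hΦ : ∀ s, HasDerivAt Φ (Φ' s) s) (hΦ' : Continuous Φ')
    (h0 : ∀ s ≤ m, Φ s = 0) (h0' : ∀ s ≤ m, Φ' s = 0) :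
    ContDiff ℝ 1 (Ω.indicator fun ξ => Φ (g ξ)) ∧
    HasCompactSupport (Ω.indicator fun ξ => Φ (g ξ)) ∧
    tsupport (Ω.indicator fun ξ => Φ (g ξ)) ⊆ Ω ∧
    ∀ ξ ∈ Ω, gradient (Ω.indicator fun ξ => Φ (g ξ)) ξ = Φ' (g ξ) • V ξ := by
  set φ := Ω.indicator fun ξ => Φ (g ξ) with hφ
  set N : Plane → Plane := Ω.indicator fun ξ => Φ' (g ξ) • V ξ with hN
  set K := closure Ω ∩ g ⁻¹' Ici m with hK
  have hKc : IsClosed K := hg.preimage_isClosed_of_isClosed isClosed_closure isClosed_Ici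
  have hKcomp : IsCompact K := hb.isCompact_closure.of_isClosed_subset hKc inter_subset_left
  have hKΩ : K ⊆ Ω := fun ξ hξ => hm ξ hξ.1 hξ.2
  have z1 : ∀ ξ ∉ K, φ ξ = 0 := fun ξ hξ => by
    by_cases h : ξ ∈ Ω
    · rw [hφ, indicator_of_mem h]
      exact h0 _ (not_le.1 fun h' => hξ ⟨subset_closure h, h'⟩).le
    · rw [hφ, indicator_of_notMem h]
  have z2 : ∀ ξ ∉ K, N ξ = 0 := fun ξ hξ => by
    by_cases h : ξ ∈ Ω
    · rw [hN, indicator_of_mem h]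
      simp [h0' _ (not_le.1 fun h' => hξ ⟨subset_closure h, h'⟩).le]
    · rw [hN, indicator_of_notMem h]
  have hsupp : tsupport φ ⊆ K := closure_minimal (fun ξ hξ => by
    by_contra h; exact hξ (z1 ξ h)) hKc
  have hgrad : ∀ ξ, HasGradientAt φ (N ξ) ξ := fun ξ => by
    by_cases h : ξ ∈ Ω
    · have e : φ =ᶠ[𝓝 ξ] fun ξ => Φ (g ξ) := by
        filter_upwards [hΩ.mem_nhds h] with η hη
        rw [hφ, indicator_of_mem hη]
      rw [hN, indicator_of_mem h, hasGradientAt_iff_hasFDerivAt]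
      refine HasFDerivAt.congr_of_eventuallyEq ?_ e
      refine ((hΦ (g ξ)).comp_hasFDerivAt ξ (hgV ξ h).hasFDerivAt).congr_fderiv ?_
      rw [map_smul]
    · have hξ : ξ ∉ K := fun h' => h (hKΩ h')
      rw [z2 ξ hξ, hasGradientAt_iff_hasFDerivAt, map_zero]
      refine (hasFDerivAt_const (0 : ℝ) ξ).congr_of_eventuallyEq ?_
      filter_upwards [hKc.isOpen_compl.mem_nhds hξ] with η hη
      exact z1 η hη
  have hNc : Continuous N := by
    rw [continuous_iff_continuousAt]
    intro ξ
    by_cases h : ξ ∈ Ω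
    · have e : N =ᶠ[𝓝 ξ] fun ξ => Φ' (g ξ) • V ξ := by
        filter_upwards [hΩ.mem_nhds h] with η hη
        rw [hN, indicator_of_mem hη]
      refine ContinuousAt.congr ?_ e.symm
      have h1 := (hgV ξ h).continuousAt
      exact (hΦ'.continuousAt.comp h1).smul (hV.continuousAt (hΩ.mem_nhds h))
    · have hξ : ξ ∉ K := fun h' => h (hKΩ h')
      refine (continuousAt_const (y := (0 : Plane))).congr ?_
      filter_upwards [hKc.isOpen_compl.mem_nhds hξ] with η hη
      exact (z2 η hη).symm
  refine ⟨?_, HasCompactSupport.of_support_subset_isCompact hKcomp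
    ((subset_tsupport φ).trans hsupp), hsupp.trans hKΩ, fun ξ hξ => ?_⟩
  · rw [contDiff_one_iff_fderiv]
    refine ⟨fun ξ => (hgrad ξ).differentiableAt, ?_⟩
    have : fderiv ℝ φ = fun ξ => InnerProductSpace.toDual ℝ Plane (N ξ) :=
      funext fun ξ => (hgrad ξ).hasFDerivAt.fderiv
    rw [this]
    exact (InnerProductSpace.toDual ℝ Plane).continuous.comp hNc
  · rw [(hgrad ξ).gradient, hN, indicator_of_mem hξ]

/-- Near the maximum set of a continuous function on a compact set, local properties hold
uniformly. -/
theorem exists_superlevel_of_eventually {K : Set Plane} (hK : IsCompact K) {g : Plane → ℝ}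
    (hg : ContinuousOn g K) {M : ℝ} (hM : ∀ ξ ∈ K, g ξ ≤ M) {P : Plane → Prop}
    (hP : ∀ ξ ∈ K, g ξ = M → ∀ᶠ η in 𝓝[K] ξ, P η) :
    ∃ m < M, ∀ ξ ∈ K, m ≤ g ξ → P ξ := by
  suffices h : ∃ m < M, ∀ ξ ∈ K, ξ ∈ K → m ≤ g ξ → P ξ by
    obtain ⟨m, h1, h2⟩ := h
    exact ⟨m, h1, fun ξ hξ => h2 ξ hξ hξ⟩
  refine hK.induction_on (p := fun S => ∃ m < M, ∀ ξ ∈ S, ξ ∈ K → m ≤ g ξ → P ξ)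
    ⟨M - 1, by linarith, by simp⟩
    (fun s t hst ⟨m, h1, h2⟩ => ⟨m, h1, fun ξ hξ => h2 ξ (hst hξ)⟩)
    (fun s t ⟨m, h1, h2⟩ ⟨m', h1', h2'⟩ => ⟨max m m', max_lt h1 h1', fun ξ hξ hK hm => ?_⟩)
    fun ξ hξ => ?_
  · rcases hξ with hξ | hξ
    · exact h2 ξ hξ hK ((le_max_left _ _).trans hm)
    · exact h2' ξ hξ hK ((le_max_right _ _).trans hm)
  · rcases (hM ξ hξ).eq_or_lt with h | h
    · exact ⟨_, hP ξ hξ h, M - 1, by linarith, fun η hη _ _ => hη⟩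
    · refine ⟨_, (hg ξ hξ).eventually (gt_mem_nhds (by linarith : g ξ < (g ξ + M) / 2)),
        (g ξ + M) / 2, by linarith, fun η hη _ h' => ?_⟩
      exact absurd h' (not_le.2 hη)

/-- Pointwise positivity of the integrand in the energy estimate near a maximum. -/
theorem energy_integrand_bound {ρ R κ ε B b l p x s g : ℝ} (hκ : 0 < κ) (hp : 0 ≤ p) (hpε : p ≤ ε)
    (hε1 : ε ≤ 1) (hb : 0 ≤ b) (hbB : b ≤ B) (hs : 0 ≤ s) (hx : |x| ≤ b * p)
    (hd : |ρ - R - κ * (x - p ^ 2 / 2)| ≤ ε * |x - p ^ 2 / 2|) (hl : l ≤ ρ - κ * b ^ 2)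
    (hg : R * s ^ 2 ≤ g) (hε2 : ε * (B + 1) ≤ κ)
    (hε3 : κ * B * ε + 2 * ε * (B + 1) * B + ε * (B + 1) ≤ 2 * l) :
    κ * (s ^ 3 / 3) ≤ (ρ * (p ^ 2 - x) * (2 * s) - 2 * ρ * s ^ 2) + (R * x * (2 * s) + 2 * g) +
      2 * κ * (x * s ^ 2 + 2 * (s ^ 3 / 3)) := by
  -- In the application `p` is the length of `V = v - w`, `b` that of `ξ - w`, `x` their inner
  -- product and `s` the excess of `ψ - w · ξ` over a level. `R` is the density with the `V` terms
  -- dropped, `κ` the derivative of density in enthalpy, and `l` the ellipticity margin.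
  have hε : 0 ≤ ε := hp.trans hpε
  have hB : 0 ≤ B := hb.trans hbB
  set d := ρ - R - κ * (x - p ^ 2 / 2) with hd'
  obtain ⟨x1, x2⟩ := abs_le.1 hx
  have hxB : |x| ≤ B * p := hx.trans (by gcongr)
  have ha : |x - p ^ 2 / 2| ≤ (B + 1) * p := by
    have h1 := abs_sub x (p ^ 2 / 2)
    rw [abs_of_nonneg (by positivity : 0 ≤ p ^ 2 / 2)] at h1
    have h2 : p * p ≤ p * 1 := by gcongr; linarith
    linarith
  have hdB : |d| ≤ ε * (B + 1) * p := hd.trans (by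
    rw [mul_assoc]; gcongr)
  have hdx : d * x ≤ ε * (B + 1) * p * (B * p) :=
    (le_abs_self _).trans (by rw [abs_mul]; gcongr)
  have hx2 : κ * x ^ 2 ≤ κ * (b ^ 2 * p ^ 2) := by
    have : x ^ 2 ≤ (b * p) ^ 2 := sq_le_sq' x1 x2
    rw [mul_pow] at this
    gcongr
  have hx3 : -(B * ε) ≤ x := by
    have h1 := neg_abs_le x
    have h2 : B * p ≤ B * ε := by gcongr
    linarith
  have hx4 : -(κ * p ^ 2 * (B * ε)) ≤ κ * p ^ 2 * x := by
    have := mul_le_mul_of_nonneg_left hx3 (by positivity : 0 ≤ κ * p ^ 2)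
    linarith
  have hl2 : l * p ^ 2 ≤ (ρ - κ * b ^ 2) * p ^ 2 := by gcongr
  -- To leading order the right side is `ρ * p ^ 2 - κ * x ^ 2`; since `|x| ≤ b * p`, ellipticity
  -- bounds it below by `l * p ^ 2`.
  have h1 : p ^ 2 * (l - κ * B * ε / 2 - ε * (B + 1) * B) ≤
      ρ * p ^ 2 - (ρ - R) * x := by
    have : (ρ - R) * x = d * x + κ * x ^ 2 - κ * p ^ 2 * x / 2 := by rw [hd']; ring
    rw [this]
    linarith
  have h2 : 2 * (d * s ^ 2) ≤ ε * (B + 1) * (s * (p ^ 2 + s ^ 2)) := by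
    have i1 : d * s ^ 2 ≤ ε * (B + 1) * p * s ^ 2 := by
      have := le_abs_self d
      gcongr
      linarith
    have i2 : 2 * (p * s ^ 2) ≤ s * (p ^ 2 + s ^ 2) := by
      nlinarith [mul_nonneg hs (sq_nonneg (p - s))]
    have := mul_le_mul_of_nonneg_left i2 (by positivity : 0 ≤ ε * (B + 1))
    linarith
  have h3 := mul_le_mul_of_nonneg_left h1 (by positivity : 0 ≤ 2 * s)
  have h4 : 0 ≤ s * p ^ 2 * (2 * l - κ * B * ε - 2 * ε * (B + 1) * B - ε * (B + 1)) :=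
    mul_nonneg (by positivity) (by linarith)
  have h5 : ε * (B + 1) * s ^ 3 ≤ κ * s ^ 3 := by gcongr
  have h6 : 0 ≤ κ * p ^ 2 * s ^ 2 := by positivity
  have h7 : (ρ - R) = d + κ * (x - p ^ 2 / 2) := by rw [hd']; ring
  have expand : (ρ * (p ^ 2 - x) * (2 * s) - 2 * ρ * s ^ 2) + (R * x * (2 * s) + 2 * g) +
      2 * κ * (x * s ^ 2 + 2 * (s ^ 3 / 3)) = 2 * s * (ρ * p ^ 2 - (ρ - R) * x) +
      2 * (g - R * s ^ 2) - 2 * (d * s ^ 2) + κ * p ^ 2 * s ^ 2 + 4 * κ * (s ^ 3 / 3) := by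
    rw [hd']; ring
  rw [expand]
  have h8 : 0 ≤ κ * s ^ 3 := by positivity
  linarith

end RegularReflection

end

/-! ### The maximum principle for continuous weak solutions -/

noncomputable section

namespace RegularReflection

open Filter Topology MeasureTheory Set

/-- Interior maxima of `ψ - w · ξ` in an elliptic region are attained on the frontier as well. -/
theorem Gas.exists_frontier_ge (G : Gas) {Ω : Set Plane} (hΩ : IsOpen Ω)
    (hb : Bornology.IsBounded Ω) {ψ : Plane → ℝ} {v : Plane → Plane} {ρ : Plane → ℝ}
    (ψ_cont : ContinuousOn ψ (closure Ω)) (v_cont : ContinuousOn v (closure Ω))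
    (ρ_cont : ContinuousOn ρ (closure Ω)) (ψ_grad : ∀ ξ ∈ Ω, HasGradientAt ψ (v ξ) ξ)
    (ρ_pos : ∀ ξ ∈ closure Ω, 0 < ρ ξ)
    (bernoulli : ∀ ξ ∈ closure Ω,
      G.enthalpy (ρ ξ) = -(ψ ξ - ‖ξ‖ ^ 2 / 2) - ‖v ξ - ξ‖ ^ 2 / 2)
    (weak_eq : ∀ φ : Plane → ℝ, ContDiff ℝ 1 φ → HasCompactSupport φ → tsupport φ ⊆ Ω →
      ∫ ξ in Ω, (ρ ξ * inner ℝ (v ξ - ξ) (gradient φ ξ) - 2 * ρ ξ * φ ξ) = 0)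
    (elliptic : ∀ ξ ∈ Ω, G.pseudoMach (ρ ξ) (v ξ - ξ) < 1) (w : Plane) {ξ₀ : Plane}
    (hξ₀ : ξ₀ ∈ Ω) (hmax : ∀ ξ ∈ closure Ω, ψ ξ - inner ℝ w ξ ≤ ψ ξ₀ - inner ℝ w ξ₀) :
    ∃ ξ ∈ frontier Ω, ψ ξ - inner ℝ w ξ = ψ ξ₀ - inner ℝ w ξ₀ := by
  by_contra! hfr
  set g : Plane → ℝ := fun ξ => ψ ξ - inner ℝ w ξ with hg
  set V : Plane → Plane := fun ξ => v ξ - w with hV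
  set M := g ξ₀ with hM
  set K := closure Ω with hK
  have hKc : IsCompact K := hb.isCompact_closure
  have hΩK : Ω ⊆ K := subset_closure
  have hgc : ContinuousOn g K := by fun_prop
  have hVc : ContinuousOn V K := by fun_prop
  have hgV : ∀ ξ ∈ Ω, HasGradientAt g (V ξ) ξ := fun ξ hξ => by
    rw [hasGradientAt_iff_hasFDerivAt, hV, map_sub]
    exact (ψ_grad ξ hξ).hasFDerivAt.sub (InnerProductSpace.toDual ℝ Plane w).hasFDerivAt
  have hZΩ : ∀ ξ ∈ K, g ξ = M → ξ ∈ Ω := fun ξ hξ h => by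
    by_contra hn
    exact hfr ξ ⟨hξ, by rwa [hΩ.interior_eq]⟩ h
  have hZV : ∀ ξ ∈ K, g ξ = M → V ξ = 0 := fun ξ hξ h => by
    have hmax' : IsLocalMax g ξ := by
      filter_upwards [hΩ.mem_nhds (hZΩ ξ hξ h)] with η hη
      rw [h]; exact hmax η (hΩK hη)
    have := hmax'.hasFDerivAt_eq_zero (hgV ξ (hZΩ ξ hξ h)).hasFDerivAt
    simpa using this
  set C := ‖w‖ ^ 2 / 2 with hC
  set hs := -M - C with hhs
  have hent : ∀ ξ ∈ K, G.enthalpy (ρ ξ) =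
      -g ξ - C + (inner ℝ (ξ - w) (V ξ) - ‖V ξ‖ ^ 2 / 2) := fun ξ hξ => by
    rw [bernoulli ξ hξ, hg, hC, hV]
    simp only [norm_sq_eq, inner_eq, PiLp.sub_apply]
    ring
  have hZent : ∀ ξ ∈ K, g ξ = M → G.enthalpy (ρ ξ) = hs := fun ξ hξ h => by
    rw [hent ξ hξ, hZV ξ hξ h, h]; simp [hhs]
  set ρs := ρ ξ₀ with hρs
  have hρs0 : 0 < ρs := ρ_pos ξ₀ (hΩK hξ₀)
  have hs0 : G.enthalpy ρs = hs := hZent ξ₀ (hΩK hξ₀) rfl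
  have hZρ : ∀ ξ ∈ K, g ξ = M → ρ ξ = ρs := fun ξ hξ h => by
    rw [← G.density_enthalpy (ρ_pos ξ hξ), hZent ξ hξ h, ← hs0, G.density_enthalpy hρs0]
  set κ := ρs / G.soundSpeed ρs ^ 2 with hκ
  have hcs := G.soundSpeed_pos hρs0
  have hκ0 : 0 < κ := by positivity
  -- At a maximum `v = w`, so the pseudo-velocity is `w - ξ` and subsonicity is exactly this
  -- inequality.
  have hZell : ∀ ξ ∈ K, g ξ = M → 0 < ρ ξ - κ * ‖ξ - w‖ ^ 2 := fun ξ hξ h => by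
    have h1 := elliptic ξ (hZΩ ξ hξ h)
    have h2 : v ξ = w := sub_eq_zero.1 (hZV ξ hξ h)
    rw [Gas.pseudoMach, hZρ ξ hξ h, h2, div_lt_one hcs, norm_sub_rev] at h1
    have h3 : ‖ξ - w‖ ^ 2 < G.soundSpeed ρs ^ 2 := by gcongr
    rw [hZρ ξ hξ h, hκ, div_mul_eq_mul_div, sub_pos, div_lt_iff₀ (by positivity)]
    gcongr
  obtain ⟨B, hB0, hB⟩ : ∃ B : ℝ, 0 ≤ B ∧ ∀ ξ ∈ K, ‖ξ - w‖ ≤ B := by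
    obtain ⟨B, hB⟩ := hKc.exists_bound_of_continuousOn (f := fun ξ => ξ - w) (by fun_prop)
    exact ⟨max B 0, le_max_right _ _, fun ξ hξ => (hB ξ hξ).trans (le_max_left _ _)⟩
  have hellc : ContinuousOn (fun ξ => ρ ξ - κ * ‖ξ - w‖ ^ 2) K := by fun_prop
  obtain ⟨l, hl0, hl⟩ : ∃ l : ℝ, 0 < l ∧
      ∀ ξ ∈ K, g ξ = M → l < ρ ξ - κ * ‖ξ - w‖ ^ 2 := by
    have hZc : IsCompact (K ∩ g ⁻¹' {M}) := hKc.of_isClosed_subset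
      (hgc.preimage_isClosed_of_isClosed isClosed_closure isClosed_singleton) inter_subset_left
    obtain ⟨ξ, hξ, hmin⟩ := hZc.exists_isMinOn ⟨ξ₀, hΩK hξ₀, rfl⟩
      (hellc.mono inter_subset_left)
    have h0 := hZell ξ hξ.1 hξ.2
    refine ⟨_, half_pos h0, fun η hη h => (half_lt_self h0).trans_le (hmin ⟨hη, h⟩)⟩
  obtain ⟨ε, hε0, hε1, hε2, hε3⟩ : ∃ ε : ℝ, 0 < ε ∧ ε < 1 ∧ ε * (B + 1) < κ ∧
      κ * B * ε + 2 * ε * (B + 1) * B + ε * (B + 1) < 2 * l := by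
    have t1 : Tendsto (fun ε : ℝ => ε * (B + 1)) (𝓝[>] 0) (𝓝 0) := by
      have : Continuous fun ε : ℝ => ε * (B + 1) := by fun_prop
      simpa using (this.tendsto 0).mono_left nhdsWithin_le_nhds
    have t2 : Tendsto (fun ε : ℝ => κ * B * ε + 2 * ε * (B + 1) * B + ε * (B + 1))
        (𝓝[>] 0) (𝓝 0) := by
      have : Continuous fun ε : ℝ => κ * B * ε + 2 * ε * (B + 1) * B + ε * (B + 1) := by
        fun_prop
      simpa using (this.tendsto 0).mono_left nhdsWithin_le_nhds
    have := (((eventually_mem_nhdsWithin (a := (0 : ℝ)) (s := Ioi 0)).and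
      (Ioo_mem_nhdsGT (zero_lt_one' ℝ))).and (t1.eventually (gt_mem_nhds hκ0))).and
      (t2.eventually (gt_mem_nhds (by positivity : 0 < 2 * l)))
    obtain ⟨ε, ⟨⟨h1, h2⟩, h3⟩, h4⟩ := this.exists
    exact ⟨ε, h1, h2.2, h3, h4⟩
  obtain ⟨m, hmM, hm⟩ := exists_superlevel_of_eventually hKc hgc (M := M) hmax
    (P := fun ξ => ξ ∈ Ω ∧ ‖V ξ‖ ≤ ε ∧ l ≤ ρ ξ - κ * ‖ξ - w‖ ^ 2 ∧
      |ρ ξ - G.density (-g ξ - C) - κ * (inner ℝ (ξ - w) (V ξ) - ‖V ξ‖ ^ 2 / 2)| ≤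
        ε * |inner ℝ (ξ - w) (V ξ) - ‖V ξ‖ ^ 2 / 2|) fun ξ hξ h => by
    have e1 : ∀ᶠ η in 𝓝[K] ξ, η ∈ Ω :=
      mem_nhdsWithin_of_mem_nhds (hΩ.mem_nhds (hZΩ ξ hξ h))
    have e2 : ∀ᶠ η in 𝓝[K] ξ, ‖V η‖ < ε := by
      refine (hVc.norm ξ hξ).eventually (gt_mem_nhds ?_)
      beta_reduce
      rw [hZV ξ hξ h, norm_zero]; exact hε0
    have e3 : ∀ᶠ η in 𝓝[K] ξ, l < ρ η - κ * ‖η - w‖ ^ 2 :=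
      (hellc ξ hξ).eventually (lt_mem_nhds (hl ξ hξ h))
    have hpair : ContinuousOn (fun η => (-g η - C + (inner ℝ (η - w) (V η) - ‖V η‖ ^ 2 / 2),
        -g η - C)) K := by fun_prop
    have hlim := hpair ξ hξ
    -- Both enthalpies vary with `η`, so strict differentiability at their common limit `hs` is
    -- needed to linearize the density difference.
    have e4 := hlim.eventually (p := fun p : ℝ × ℝ =>
        ‖G.density p.1 - G.density p.2 - (ContinuousLinearMap.toSpanSingleton ℝ κ) (p.1 - p.2)‖
          ≤ ε * ‖p.1 - p.2‖) (by
      have e := (G.hasStrictDerivAt_density hρs0).hasStrictFDerivAt.isLittleO.def hε0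
      rw [hs0] at e
      convert e using 2
      beta_reduce
      rw [hZV ξ hξ h, h]; simp [hhs])
    filter_upwards [e1, e2, e3, e4, self_mem_nhdsWithin] with η h1 h2 h3 h4 h5
    refine ⟨h1, h2.le, h3.le, ?_⟩
    rw [← hent η h5, G.density_enthalpy (ρ_pos η h5)] at h4
    have h6 : G.enthalpy (ρ η) - (-g η - C) = inner ℝ (η - w) (V η) - ‖V η‖ ^ 2 / 2 := by
      rw [hent η h5]; ring
    rw [h6] at h4
    simpa [mul_comm] using h4
  have hmΩ : ∀ ξ ∈ K, m ≤ g ξ → ξ ∈ Ω := fun ξ hξ h => (hm ξ hξ h).1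
  set R : ℝ → ℝ := fun s => G.density (-s - C) with hR
  have hRc : Continuous R := G.continuous_density.comp (by fun_prop)
  -- Chosen so that the gradient of `P (g ξ)` is `R (g ξ)` times the gradient of the squared excess:
  -- its divergence identity removes the part of the flux with density `R`.
  set P : ℝ → ℝ := fun s => ∫ t in m..s, R t * (2 * max (t - m) 0) with hP
  have hP' : ∀ s, HasDerivAt P (R s * (2 * max (s - m) 0)) s := fun s =>
    intervalIntegral.integral_hasDerivAt_right
      (Continuous.intervalIntegrable (by fun_prop) _ _)
      (Continuous.stronglyMeasurableAtFilter (by fun_prop) _ _)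
      (Continuous.continuousAt (by fun_prop))
  have hP0 : ∀ s ≤ m, P s = 0 := fun s hsm => by
    rw [hP]
    refine (intervalIntegral.integral_congr (g := fun _ => 0) fun t ht => ?_).trans (by simp)
    rw [uIcc_of_ge hsm] at ht
    simp [max_eq_right (sub_nonpos.2 ht.2)]
  have hF' : ∀ s, HasDerivAt (fun s => max (s - m) 0 ^ 2) (2 * max (s - m) 0) s := fun s => by
    simpa using hasDerivAt_posPart_pow m 0 s
  have hQ' : ∀ s, HasDerivAt (fun s => max (s - m) 0 ^ 3 / 3) (max (s - m) 0 ^ 2) s := fun s => by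
    refine ((hasDerivAt_posPart_pow m 1 s).div_const 3).congr_deriv ?_
    push_cast; ring
  -- `R` is decreasing on `[m, M]`, which gives the zero-order terms a favourable sign.
  have hPge : ∀ s, m ≤ s → s ≤ M → R s * max (s - m) 0 ^ 2 ≤ P s := fun s h1 h2 => by
    have i1 : ∫ t in m..s, R s * (2 * max (t - m) 0) = R s * max (s - m) 0 ^ 2 := by
      rw [intervalIntegral.integral_const_mul, intervalIntegral.integral_eq_sub_of_hasDerivAt
        (fun t _ => hF' t) (Continuous.intervalIntegrable (by fun_prop) _ _)]
      simp
    rw [← i1]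
    refine intervalIntegral.integral_mono_on h1 (Continuous.intervalIntegrable (by fun_prop) _ _)
      (Continuous.intervalIntegrable (by fun_prop) _ _) fun t ht => ?_
    refine mul_le_mul_of_nonneg_right (G.density_le_density ?_ (by linarith [ht.2]))
      (by positivity)
    have h3 := G.base_enthalpy_pos hρs0
    have h4 := G.coeff_pos
    rw [hs0] at h3
    refine h3.le.trans ?_
    gcongr
    linarith
  have hVΩ := hVc.mono hΩK
  obtain ⟨a1, a2, a3, a4⟩ := testFunction_comp hΩ hb hgc hVΩ hgV hmΩ hF' (by fun_prop)
    (fun s h => by simp [max_eq_right (sub_nonpos.2 h)])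
    (fun s h => by simp [max_eq_right (sub_nonpos.2 h)])
  obtain ⟨b1, b2, b3, b4⟩ := testFunction_comp hΩ hb hgc hVΩ hgV hmΩ hQ' (by fun_prop)
    (fun s h => by simp [max_eq_right (sub_nonpos.2 h)])
    (fun s h => by simp [max_eq_right (sub_nonpos.2 h)])
  obtain ⟨c1, c2, c3, c4⟩ := testFunction_comp hΩ hb hgc hVΩ hgV hmΩ hP' (by fun_prop) hP0
    (fun s h => by simp [max_eq_right (sub_nonpos.2 h)])
  have toΩ : ∀ φ : Plane → ℝ, tsupport φ ⊆ Ω →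
      ∫ ξ, (inner ℝ (ξ - w) (gradient φ ξ) + 2 * φ ξ) =
      ∫ ξ in Ω, (inner ℝ (ξ - w) (gradient φ ξ) + 2 * φ ξ) := fun φ hφ => by
    refine (setIntegral_eq_integral_of_forall_compl_eq_zero fun ξ hξ => ?_).symm
    have hξ' : ξ ∉ tsupport φ := fun h => hξ (hφ h)
    have h1 : fderiv ℝ φ ξ = 0 := image_eq_zero_of_notMem_tsupport fun h =>
      hξ' (tsupport_fderiv_subset ℝ h)
    simp [gradient, h1, image_eq_zero_of_notMem_tsupport hξ']
  set X : Plane → ℝ := fun ξ => inner ℝ (ξ - w) (V ξ) with hX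
  have hXc : ContinuousOn X K := by fun_prop
  set S : Plane → ℝ := fun ξ => max (g ξ - m) 0 with hS
  have hSc : ContinuousOn S K := by fun_prop
  have hPc : Continuous P := continuous_iff_continuousAt.2 fun s => (hP' s).continuousAt
  have hPgc : ContinuousOn (fun ξ => P (g ξ)) K := hPc.comp_continuousOn hgc
  have hRgc : ContinuousOn (fun ξ => R (g ξ)) K := hRc.comp_continuousOn hgc
  -- Only `T1` uses the flow equation; `T2` and `T3` are divergence identities. The combination `T1
  -- + T2 + 2κ T3` has an integrand of at least `κ S³ / 3`, which is positive near `ξ₀`.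
  have T1 : ∫ ξ in Ω, (ρ ξ * (‖V ξ‖ ^ 2 - X ξ) * (2 * S ξ) - 2 * ρ ξ * S ξ ^ 2) = 0 := by
    rw [← weak_eq _ a1 a2 a3]
    refine setIntegral_congr_fun hΩ.measurableSet fun ξ hξ => ?_
    simp only [a4 ξ hξ, indicator_of_mem hξ, hS, hX, hV, norm_sq_eq, inner_eq, PiLp.sub_apply,
      PiLp.smul_apply, smul_eq_mul]
    ring
  have T2 : ∫ ξ in Ω, (R (g ξ) * X ξ * (2 * S ξ) + 2 * P (g ξ)) = 0 := by
    rw [← integral_div_eq_zero c1 c2 w, toΩ _ c3]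
    refine setIntegral_congr_fun hΩ.measurableSet fun ξ hξ => ?_
    simp only [c4 ξ hξ, indicator_of_mem hξ, hS, hX, hV, inner_eq, PiLp.sub_apply,
      PiLp.smul_apply, smul_eq_mul]
    ring
  have T3 : ∫ ξ in Ω, (X ξ * S ξ ^ 2 + 2 * (S ξ ^ 3 / 3)) = 0 := by
    rw [← integral_div_eq_zero b1 b2 w, toΩ _ b3]
    refine setIntegral_congr_fun hΩ.measurableSet fun ξ hξ => ?_
    simp only [b4 ξ hξ, indicator_of_mem hξ, hS, hX, hV, inner_eq, PiLp.sub_apply,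
      PiLp.smul_apply, smul_eq_mul]
    ring
  have integ : ∀ f : Plane → ℝ, ContinuousOn f K → IntegrableOn f Ω := fun f hf =>
    (hf.integrableOn_compact hKc).mono_set hΩK
  have I1 := integ (fun ξ => ρ ξ * (‖V ξ‖ ^ 2 - X ξ) * (2 * S ξ) - 2 * ρ ξ * S ξ ^ 2)
    (by fun_prop)
  have I2 := integ (fun ξ => R (g ξ) * X ξ * (2 * S ξ) + 2 * P (g ξ)) (by fun_prop)
  have I3 := integ (fun ξ => X ξ * S ξ ^ 2 + 2 * (S ξ ^ 3 / 3)) (by fun_prop)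
  have I4 := integ (fun ξ => κ * (S ξ ^ 3 / 3)) (by fun_prop)
  have I12 : IntegrableOn (fun ξ => (ρ ξ * (‖V ξ‖ ^ 2 - X ξ) * (2 * S ξ) - 2 * ρ ξ * S ξ ^ 2) +
      (R (g ξ) * X ξ * (2 * S ξ) + 2 * P (g ξ))) Ω := I1.add I2
  have I123 : IntegrableOn (fun ξ => (ρ ξ * (‖V ξ‖ ^ 2 - X ξ) * (2 * S ξ) - 2 * ρ ξ * S ξ ^ 2) +
      (R (g ξ) * X ξ * (2 * S ξ) + 2 * P (g ξ)) +
      2 * κ * (X ξ * S ξ ^ 2 + 2 * (S ξ ^ 3 / 3))) Ω := I12.add (I3.const_mul (2 * κ))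
  have sum0 : ∫ ξ in Ω, ((ρ ξ * (‖V ξ‖ ^ 2 - X ξ) * (2 * S ξ) - 2 * ρ ξ * S ξ ^ 2) +
      (R (g ξ) * X ξ * (2 * S ξ) + 2 * P (g ξ)) +
      2 * κ * (X ξ * S ξ ^ 2 + 2 * (S ξ ^ 3 / 3))) = 0 := by
    rw [integral_add I12 (I3.const_mul (2 * κ)), integral_add I1 I2, integral_const_mul,
      T1, T2, T3]
    ring
  have le0 : ∫ ξ in Ω, κ * (S ξ ^ 3 / 3) ≤ 0 := by
    rw [← sum0]
    refine setIntegral_mono_on I4 I123 hΩ.measurableSet fun ξ hξ => ?_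
    rcases le_or_gt (g ξ) m with h | h
    · have : S ξ = 0 := max_eq_right (sub_nonpos.2 h)
      simp [this, hP0 _ h]
    · obtain ⟨-, p1, p2, p3⟩ := hm ξ (hΩK hξ) h.le
      exact energy_integrand_bound hκ0 (norm_nonneg _) p1 hε1.le (norm_nonneg (ξ - w))
        (hB ξ (hΩK hξ)) (le_max_right _ _) (abs_real_inner_le_norm _ _) p3 p2
        (hPge _ h.le (hmax ξ (hΩK hξ))) hε2.le hε3.le
  have pos : 0 < ∫ ξ in Ω, κ * (S ξ ^ 3 / 3) := by
    have hnn : ∀ ξ, 0 ≤ κ * (S ξ ^ 3 / 3) := fun ξ => by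
      have : 0 ≤ S ξ := le_max_right _ _
      positivity
    rw [setIntegral_pos_iff_support_of_nonneg_ae (Eventually.of_forall hnn) I4]
    have hopen : IsOpen (Ω ∩ g ⁻¹' Ioi m) := (hgc.mono hΩK).isOpen_inter_preimage hΩ isOpen_Ioi
    refine (hopen.measure_pos volume ⟨ξ₀, hξ₀, hmM⟩).trans_le (measure_mono fun ξ hξ => ⟨?_, hξ.1⟩)
    have h1 : 0 < g ξ - m := sub_pos.2 hξ.2
    have h2 : 0 < S ξ := lt_max_of_lt_left h1
    exact (by positivity : 0 < κ * (S ξ ^ 3 / 3)).ne'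
  exact absurd le0 (not_le.2 pos)

end RegularReflection

end

/-! ### Shocks at the reflection point -/

noncomputable section

namespace RegularReflection

open Filter Topology MeasureTheory Set

/-- Equal tangential components make the jump normal, and admissibility fixes its sign. This lets
the velocity jump stand in for the unknown shock normal. -/
theorem Gas.IsShock.exists_jump {G : Gas} {n zu zd : Plane} {ρu ρd : ℝ}
    (h : G.IsShock n ρu zu ρd zd) (hne : zd ≠ zu) :
    ∃ κ : ℝ, 0 < κ ∧ ∀ i, zu i - zd i = κ * n i := by
  have ht := h.tangential
  have hp := h.normal_pos
  have ha := h.admissible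
  simp only [inner_eq, rot90_zero, rot90_one] at ht hp ha
  have hN : 0 < n 0 ^ 2 + n 1 ^ 2 := by
    by_contra! hle
    have h0 : n 0 = 0 := by nlinarith [sq_nonneg (n 0), sq_nonneg (n 1)]
    have h1 : n 1 = 0 := by nlinarith [sq_nonneg (n 0), sq_nonneg (n 1)]
    rw [h0, h1] at hp; simp at hp
  have e0 : zu 0 - zd 0 = (((zu 0 - zd 0) * n 0 + (zu 1 - zd 1) * n 1) /
      (n 0 ^ 2 + n 1 ^ 2)) * n 0 := by
    field_simp
    linear_combination (-n 1) * ht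
  have e1 : zu 1 - zd 1 = (((zu 0 - zd 0) * n 0 + (zu 1 - zd 1) * n 1) /
      (n 0 ^ 2 + n 1 ^ 2)) * n 1 := by
    field_simp
    linear_combination (n 0) * ht
  have hκ : 0 ≤ ((zu 0 - zd 0) * n 0 + (zu 1 - zd 1) * n 1) / (n 0 ^ 2 + n 1 ^ 2) :=
    div_nonneg (by linarith) hN.le
  refine ⟨_, hκ.lt_of_ne fun h0 => hne ?_, fun i => by fin_cases i <;> assumption⟩
  rw [← h0, zero_mul] at e0 e1
  exact plane_ext (by linarith) (by linarith)

/-- A shock whose downstream velocity is parallel to a given direction, in terms of the downstream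
speed `q` in that direction. -/
theorem Gas.IsShock.polar {G : Gas} {n zu zd : Plane} {ρu ρd θ : ℝ}
    (h : G.IsShock n ρu zu ρd zd) (hne : zd ≠ zu) (hu : 0 < ρu) (hd : 0 < ρd) {q : ℝ}
    (hq : zd = -q • dir θ)
    (hpos : 0 < inner ℝ zu (-dir θ) ∨ 0 < q) :
    0 < q ∧ q < inner ℝ zu (-dir θ) ∧ q ∈ G.speeds (G.enthalpy ρu + ‖zu‖ ^ 2 / 2) ∧
    ρu * (‖zu‖ ^ 2 - inner ℝ zu (-dir θ) * q) =
      G.density (G.enthalpy ρu + ‖zu‖ ^ 2 / 2 - q ^ 2 / 2) * q *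
        (inner ℝ zu (-dir θ) - q) := by
  obtain ⟨κ, hκ, hj⟩ := h.exists_jump hne
  have hb := h.bernoulli
  have hm := h.mass
  have hp := h.normal_pos
  have hcs := Real.sin_sq_add_cos_sq θ
  have e : G.enthalpy ρu + ‖zu‖ ^ 2 / 2 - q ^ 2 / 2 = G.enthalpy ρd := by
    have : ‖zd‖ ^ 2 = q ^ 2 := by
      rw [hq, norm_sq_eq]
      simp only [PiLp.smul_apply, dir_zero, dir_one, smul_eq_mul]
      linear_combination q ^ 2 * hcs
    rw [hb, this]; ring
  rw [e, G.density_enthalpy hd]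
  have j0 := hj 0
  have j1 := hj 1
  simp only [hq, inner_eq, norm_sq_eq, PiLp.smul_apply, PiLp.neg_apply, dir_zero, dir_one,
    smul_eq_mul] at hm hp hpos j0 j1 ⊢
  set a := zu 0 * -Real.cos θ + zu 1 * -Real.sin θ with ha
  -- Scaling the mass condition by `κ` replaces `n` by the jump and eliminates the shock direction.
  have m1 : κ * (zu 0 * n 0 + zu 1 * n 1) = zu 0 ^ 2 + zu 1 ^ 2 - a * q := by
    rw [ha]
    linear_combination (-zu 0) * j0 + (-zu 1) * j1
  have m2 : κ * (-q * Real.cos θ * n 0 + -q * Real.sin θ * n 1) = q * (a - q) := by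
    rw [ha]
    linear_combination (q * Real.cos θ) * j0 + (q * Real.sin θ) * j1 - q ^ 2 * hcs
  have m3 : ρu * (zu 0 ^ 2 + zu 1 ^ 2 - a * q) = ρd * (q * (a - q)) := by
    rw [← m1, ← m2]
    linear_combination κ * hm
  have m4 : 0 < q * (a - q) := by
    have h1 : 0 < zu 0 ^ 2 + zu 1 ^ 2 - a * q := by rw [← m1]; positivity
    have : 0 < ρd * (q * (a - q)) := by rw [← m3]; positivity
    exact (pos_iff_pos_of_mul_pos this).1 hd
  have hq0 : 0 < q := by
    rcases hpos with h | h
    · by_contra! hle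
      nlinarith
    · exact h
  have hqa : 0 < a - q := (pos_iff_pos_of_mul_pos m4).1 hq0
  refine ⟨hq0, by linarith, ⟨hq0, ?_⟩, by rw [m3]; ring⟩
  have e' := G.base_enthalpy_pos hd
  rw [← e, norm_sq_eq] at e'
  exact e'

namespace Incident

variable {G : Gas} {ρ₁ M₁ α θ : ℝ} (I : Incident G ρ₁ M₁ α θ)

theorem reflectionPoint_zero : I.reflectionPoint 0 = I.r * Real.cos θ := rfl

theorem reflectionPoint_one : I.reflectionPoint 1 = I.r * Real.sin θ := rfl

/-- Here `q` is the signed speed towards the corner relative to the reflection point; `q = I.r` is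
fluid at rest, and `I.r < q` means motion towards the corner. -/
theorem exists_speed {v : Plane} (hθ : 0 < Real.sin θ)
    (hv : inner ℝ v (reflectionWallNormal θ) = 0) :
    ∃ q : ℝ, v - I.reflectionPoint = -q • dir θ ∧ v 0 = -(q - I.r) * Real.cos θ ∧
      v 1 = -(q - I.r) * Real.sin θ := by
  have hcs := Real.sin_sq_add_cos_sq θ
  rw [inner_eq, reflectionWallNormal_zero, reflectionWallNormal_one] at hv
  have h0 : v 0 = -((I.r - v 1 / Real.sin θ) - I.r) * Real.cos θ := by
    field_simp
    linarith
  have h1 : v 1 = -((I.r - v 1 / Real.sin θ) - I.r) * Real.sin θ := by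
    field_simp
    ring
  refine ⟨I.r - v 1 / Real.sin θ, plane_ext ?_ ?_, h0, h1⟩
  · simp only [PiLp.sub_apply, PiLp.smul_apply, reflectionPoint_zero, dir_zero, smul_eq_mul]
    linarith
  · simp only [PiLp.sub_apply, PiLp.smul_apply, reflectionPoint_one, dir_one, smul_eq_mul]
    linarith

/-- Consequences of a violated angle condition: the sign of the 2-sector velocity, the wall angle,
and the weakness of a shock at the reflection point that is parallel to the vertical axis. Moreover
every shock at the reflection point with downstream flow along the wall has downstream velocity
towards the corner. -/
theorem of_not_angleCondition (hθ : θ ∈ Ioo 0 Real.pi) (hα : α + θ ∈ Ioo 0 Real.pi)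
    (hangle : ¬ I.AngleCondition) :
    0 < I.v₂ 0 ∧ Real.cos θ < 0 ∧
    G.density (G.enthalpy I.ρ₂ + I.v₂ 0 ^ 2 / 2 + I.v₂ 0 * -(I.r * Real.cos θ)) *
      -(I.r * Real.cos θ) < I.ρ₂ * (I.v₂ 0 + -(I.r * Real.cos θ)) ∧
    ∀ n ρ v, 0 < ρ → inner ℝ v (reflectionWallNormal θ) = 0 →
      G.IsShock n I.ρ₂ (I.v₂ - I.reflectionPoint) ρ (v - I.reflectionPoint) →
      0 < inner ℝ v (-dir θ) := by
  have hs : 0 < Real.sin θ := Real.sin_pos_of_mem_Ioo hθ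
  have hr := I.r_pos
  have hcs := Real.sin_sq_add_cos_sq θ
  have hρ₂ := I.ρ₂_pos
  simp only [AngleCondition] at hangle
  push Not at hangle
  obtain ⟨ω, ρ, v, ⟨hRR, ω', ρ', v', hRR', hlt⟩, hang⟩ := hangle
  have hω : 0 < Real.cos ω := by
    by_contra! hle
    refine hang.not_ge ?_
    rw [InnerProductGeometry.angle, Real.arccos_le_pi_div_two]
    refine div_nonneg ?_ (by positivity)
    simp only [inner_eq, PiLp.neg_apply, dir_zero, dir_one, Real.cos_zero, Real.sin_zero]
    linarith
  obtain ⟨q, hq, -, hv1⟩ := I.exists_speed hs hRR.slip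
  obtain ⟨q', hq', -, -⟩ := I.exists_speed hs hRR'.slip
  have hq0 : 0 < q := by
    have h1 := hRR.shock.mass
    have h2 : 0 < ρ * inner ℝ (v - I.reflectionPoint) (rot90 (dir ω)) := by
      rw [← h1]; exact mul_pos hρ₂ hRR.shock.normal_pos
    have h3 := (pos_iff_pos_of_mul_pos h2).1 hRR.density_pos
    have h4 : inner ℝ (v - I.reflectionPoint) (rot90 (dir ω)) = q * Real.sin (ω - θ) := by
      rw [hq, inner_eq, Real.sin_sub]
      simp only [PiLp.smul_apply, rot90_zero, rot90_one, dir_zero, dir_one, smul_eq_mul]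
      ring
    rw [h4] at h3
    have h5 : 0 < Real.sin (ω - θ) := by
      obtain ⟨b1, b2⟩ := hRR.between
      exact Real.sin_pos_of_mem_Ioo ⟨by linarith [hα.2], by linarith⟩
    exact (pos_iff_pos_of_mul_pos h3).2 h5
  have sub_ne : ∀ {x : Plane}, x ≠ I.v₂ → x - I.reflectionPoint ≠ I.v₂ - I.reflectionPoint :=
    fun hx h => hx (sub_left_injective h)
  obtain ⟨-, p2, p3, p4⟩ := hRR.shock.polar (sub_ne hRR.jump) hρ₂ hRR.density_pos hq (Or.inr hq0)
  obtain ⟨r1, r2, r3, r4⟩ := hRR'.shock.polar (sub_ne hRR'.jump) hρ₂ hRR'.density_pos hq'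
    (Or.inl (hq0.trans p2))
  have hqq' : q < q' := by
    rw [hq, hq'] at hlt
    have hdir : ‖dir θ‖ = 1 := by
      have : ‖dir θ‖ ^ 2 = 1 := by rw [norm_sq_eq, dir_zero, dir_one]; linarith
      exact (pow_eq_one_iff_of_nonneg (norm_nonneg _) two_ne_zero).1 this
    simpa [norm_smul, hdir, abs_of_pos hq0, abs_of_pos r1] using hlt
  -- The vertical component of the normal is `cos ω > 0` and `v₂` is horizontal, so the downstream
  -- fluid moves down the wall.
  have hqr : I.r < q := by
    obtain ⟨κ, hκ, hj⟩ := hRR.shock.exists_jump (sub_ne hRR.jump)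
    have := hj 1
    simp only [PiLp.sub_apply, rot90_one, dir_zero, I.slip, hv1] at this
    have h2 := mul_pos hκ hω
    have h3 : 0 < (q - I.r) * Real.sin θ := by linarith
    linarith [(pos_iff_pos_of_mul_pos h3).2 hs]
  set a : ℝ := inner ℝ (I.v₂ - I.reflectionPoint) (-dir θ) with ha
  have ha' : a = I.r - I.v₂ 0 * Real.cos θ := by
    rw [ha, inner_eq]
    simp only [PiLp.sub_apply, PiLp.neg_apply, dir_zero, dir_one, I.slip, reflectionPoint_zero,
      reflectionPoint_one]
    linear_combination I.r * hcs
  have hQ : ‖I.v₂ - I.reflectionPoint‖ ^ 2 =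
      I.v₂ 0 ^ 2 - 2 * I.v₂ 0 * I.r * Real.cos θ + I.r ^ 2 := by
    rw [norm_sq_eq]
    simp only [PiLp.sub_apply, I.slip, reflectionPoint_zero, reflectionPoint_one]
    linear_combination I.r ^ 2 * hcs
  have hQa : a ^ 2 ≤ ‖I.v₂ - I.reflectionPoint‖ ^ 2 := by
    rw [ha', hQ]
    nlinarith [sq_nonneg (I.v₂ 0 * Real.sin θ)]
  have huc : I.v₂ 0 * Real.cos θ < 0 := by linarith
  -- Otherwise `u < 0` and `θ < π / 2`; the incident shock relation then gives `α + θ < π / 2`, and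
  -- every admissible direction `ω` has negative cosine.
  have hu : 0 < I.v₂ 0 := by
    by_contra! hle
    have hu' : I.v₂ 0 < 0 := hle.lt_of_ne fun h => by simp [h] at huc
    have hc : 0 < Real.cos θ := by
      by_contra! h
      exact absurd huc (not_lt.2 (mul_nonneg_of_nonpos_of_nonpos hle h))
    have hθ2 : θ < Real.pi / 2 := by
      by_contra! h
      have := Real.cos_nonpos_of_pi_div_two_le_of_le h (by linarith [hθ.2, Real.pi_pos])
      linarith
    obtain ⟨κ, hκ, hj⟩ := I.shock.exists_jump (fun h => I.jump (sub_left_injective h))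
    have hm := I.mach
    have m0 := congrArg (fun x : Plane => x 0) hm
    have m1 := congrArg (fun x : Plane => x 1) hm
    have j0 := hj 0
    have j1 := hj 1
    simp only [PiLp.sub_apply, PiLp.smul_apply, dir_zero, dir_one, rot90_zero, rot90_one,
      smul_eq_mul, I.slip, Real.sin_pi_sub, Real.cos_pi_sub] at m0 m1 j0 j1
    have hκu : I.v₂ 0 * Real.sin θ = -(κ * Real.cos (α + θ)) := by
      rw [Real.cos_add]
      linear_combination (-Real.sin θ) * j0 + Real.cos θ * j1 + Real.sin θ * m0 - Real.cos θ * m1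
    have hcα : 0 < Real.cos (α + θ) := by
      have h1 : I.v₂ 0 * Real.sin θ < 0 := mul_neg_of_neg_of_pos hu' hs
      have : 0 < κ * Real.cos (α + θ) := by linarith
      exact (pos_iff_pos_of_mul_pos this).1 hκ
    have hα2 : α + θ < Real.pi / 2 := by
      by_contra! h
      have := Real.cos_nonpos_of_pi_div_two_le_of_le h (by linarith [hα.2, Real.pi_pos])
      linarith
    obtain ⟨b1, b2⟩ := hRR.between
    have := Real.cos_neg_of_pi_div_two_lt_of_lt (x := ω) (by linarith [hθ.1]) (by linarith)
    linarith
  have hc : Real.cos θ < 0 := by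
    by_contra! h
    exact absurd huc (not_lt.2 (mul_nonneg hu.le h))
  refine ⟨hu, hc, ?_, fun n ρ₃ v₃ hρ₃ hv₃ hsh => ?_⟩
  -- At speed `I.r` both sides of the polar inequality contain the factor `u`, which is divided out.
  · have h := G.polar_lt hQa hρ₂ hr hqr hqq' r2 r3 p4 r4
    have e1 : G.enthalpy I.ρ₂ + ‖I.v₂ - I.reflectionPoint‖ ^ 2 / 2 - I.r ^ 2 / 2 =
        G.enthalpy I.ρ₂ + I.v₂ 0 ^ 2 / 2 + I.v₂ 0 * -(I.r * Real.cos θ) := by rw [hQ]; ring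
    have e2 : I.ρ₂ * (‖I.v₂ - I.reflectionPoint‖ ^ 2 - a * I.r) =
        I.ρ₂ * (I.v₂ 0 + -(I.r * Real.cos θ)) * I.v₂ 0 := by rw [hQ, ha']; ring
    rw [e1, e2, ha'] at h
    refine lt_of_mul_lt_mul_right ?_ hu.le
    linarith
  · obtain ⟨q₃, hq₃, h0, h1⟩ := I.exists_speed hs hv₃
    have hne : v₃ ≠ I.v₂ := fun h => by
      rw [h, inner_eq, I.slip] at hv₃
      simp only [reflectionWallNormal_zero, zero_mul, add_zero] at hv₃
      exact (mul_pos hu hs).ne' hv₃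
    obtain ⟨g1, -, -, g4⟩ := hsh.polar (sub_ne hne) hρ₂ hρ₃ hq₃ (Or.inl (hq0.trans p2))
    -- Below the strong-type speed the mass balance is strict, so no shock has a smaller downstream
    -- speed.
    have hge : q ≤ q₃ := by
      by_contra! hlt'
      have := G.polar_lt hQa hρ₂ g1 hlt' hqq' r2 r3 p4 r4
      exact absurd g4 this.ne'
    have : inner ℝ v₃ (-dir θ) = q₃ - I.r := by
      rw [inner_eq, PiLp.neg_apply, PiLp.neg_apply, dir_zero, dir_one, h0, h1]
      linear_combination (q₃ - I.r) * hcs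
    rw [this]
    linarith

end Incident

end RegularReflection

end

/-! ### The maximum of the potential over the 3-sector -/

noncomputable section

namespace RegularReflection

open Filter Topology MeasureTheory Set

theorem isOpen_fluidDomain (θ : ℝ) : IsOpen (fluidDomain θ) :=
  have h1 : IsOpen {ξ : Plane | 0 < ξ 1} := isOpen_lt continuous_const (by fun_prop)
  have h2 : IsOpen {ξ : Plane | inner ℝ ξ (reflectionWallNormal θ) < 0} :=
    isOpen_lt (by fun_prop) continuous_const
  h1.inter h2

theorem convex_fluidDomain (θ : ℝ) : Convex ℝ (fluidDomain θ) := by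
  intro x hx y hy a b ha hb hab
  simp only [fluidDomain, mem_ofPred_eq, inner_eq, PiLp.add_apply, PiLp.smul_apply, smul_eq_mul,
    reflectionWallNormal_zero, reflectionWallNormal_one] at *
  refine ⟨convex_Ioi (0 : ℝ) hx.1 hy.1 ha hb hab, ?_⟩
  have := convex_Iio (0 : ℝ) hx.2 hy.2 ha hb hab
  simp only [smul_eq_mul, mem_Iio] at this
  linarith

theorem dir_mem_fluidDomain {θ : ℝ} (hθ : θ ∈ Ioo 0 Real.pi) :
    dir ((θ + Real.pi) / 2) ∈ fluidDomain θ := by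
  have h1 := hθ.1
  have h2 := hθ.2
  refine ⟨Real.sin_pos_of_mem_Ioo ⟨by linarith, by linarith⟩, ?_⟩
  have : 0 < Real.sin ((θ + Real.pi) / 2 - θ) :=
    Real.sin_pos_of_mem_Ioo ⟨by linarith, by linarith⟩
  rw [Real.sin_sub] at this
  simp only [inner_eq, dir_zero, dir_one, reflectionWallNormal_zero, reflectionWallNormal_one]
  linarith

theorem mem_closure_fluidDomain {θ : ℝ} (hθ : θ ∈ Ioo 0 Real.pi) {ξ : Plane} (h1 : 0 ≤ ξ 1)
    (h2 : inner ℝ ξ (reflectionWallNormal θ) ≤ 0) : ξ ∈ closure (fluidDomain θ) := by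
  obtain ⟨d1, d2⟩ := dir_mem_fluidDomain hθ
  set d := dir ((θ + Real.pi) / 2)
  have hlim : Tendsto (fun t : ℝ => ξ + t • d) (𝓝[>] 0) (𝓝 ξ) := by
    have : Continuous fun t : ℝ => ξ + t • d := by fun_prop
    simpa using (this.tendsto 0).mono_left nhdsWithin_le_nhds
  refine mem_closure_of_tendsto hlim ?_
  filter_upwards [self_mem_nhdsWithin] with t (ht : 0 < t)
  refine ⟨?_, ?_⟩
  · simp only [PiLp.add_apply, PiLp.smul_apply, smul_eq_mul]
    have := mul_pos ht d1
    linarith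
  · rw [inner_add_left, real_inner_smul_left]
    have := mul_neg_of_pos_of_neg ht d2
    linarith

/-- First-order condition at a maximum, from one side along a line. -/
theorem deriv_nonpos_of_max {f f' : ℝ → ℝ} {e : ℝ} (hf : ContinuousWithinAt f (Ioi 0) 0)
    (hd : ∀ᶠ τ in 𝓝[>] (0 : ℝ), HasDerivAt f (f' τ) τ) (hl : Tendsto f' (𝓝[>] 0) (𝓝 e))
    (hmax : ∀ᶠ τ in 𝓝[>] (0 : ℝ), f τ ≤ f 0) : e ≤ 0 := by
  obtain ⟨δ, hδ, hsub⟩ := mem_nhdsGT_iff_exists_Ioo_subset.1 hd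
  have hδ0 : (0 : ℝ) < δ := hδ
  have h1 : HasDerivWithinAt f e (Ici 0) 0 := by
    refine hasDerivWithinAt_Ici_of_tendsto_deriv (s := Ioo 0 δ)
      (fun τ hτ => (hsub hτ).differentiableAt.differentiableWithinAt)
      (hf.mono Ioo_subset_Ioi_self) (Ioo_mem_nhdsGT hδ0) (hl.congr' ?_)
    filter_upwards [hd] with τ hτ using hτ.deriv.symm
  have h2 : IsLocalMaxOn f (Ici 0) 0 := by
    have : 𝓝[≥] (0 : ℝ) = pure 0 ⊔ 𝓝[>] 0 := by
      rw [← Ioi_insert, nhdsWithin_insert]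
    rw [IsLocalMaxOn, IsMaxFilter, this, eventually_sup]
    exact ⟨by simp, hmax⟩
  have h3 := h2.hasFDerivWithinAt_nonpos h1.hasFDerivWithinAt
    (y := 1) (mem_posTangentConeAt_of_segment_subset (by
      rw [segment_eq_Icc (by norm_num)]; exact Icc_subset_Ici_self))
  simpa using h3

namespace Incident.GlobalRR

variable {G : Gas} {ρ₁ M₁ α θ : ℝ} {I : Incident G ρ₁ M₁ α θ} (R : I.GlobalRR)

/-- The reflected shock with its endpoints. -/
def shockCurve : Set Plane := R.s '' Icc 0 1

theorem continuousOn_s : ContinuousOn R.s (Icc 0 1) := fun t ht =>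
  (R.s_deriv t ht).continuousWithinAt

theorem isCompact_shockCurve : IsCompact R.shockCurve :=
  isCompact_Icc.image_of_continuousOn R.continuousOn_s

theorem shockCurve_subset : R.shockCurve ⊆ closure R.Ω := fun ξ hξ =>
  frontier_subset_closure (by rw [R.Ω_frontier]; exact Or.inl (Or.inl hξ))

theorem wall_opposite {ξ : Plane} (h : ξ ∈ segment ℝ 0 (R.s 1)) :
    ∃ x, 0 ≤ x ∧ x ≤ R.a ∧ ξ 0 = -x ∧ ξ 1 = 0 := by
  rw [segment_eq_image] at h
  obtain ⟨t, ⟨h0, h1⟩, rfl⟩ := h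
  have := R.a_pos
  refine ⟨t * R.a, by positivity, by nlinarith, ?_, ?_⟩ <;> simp [R.s_one]

theorem wall_reflection {ξ : Plane} (h : ξ ∈ segment ℝ 0 I.reflectionPoint) :
    ∃ x, 0 ≤ x ∧ x ≤ I.r ∧ ξ = x • dir θ := by
  rw [segment_eq_image] at h
  obtain ⟨t, ⟨h0, h1⟩, rfl⟩ := h
  have := I.r_pos
  refine ⟨t * I.r, by positivity, by nlinarith, ?_⟩
  simp [reflectionPoint, mul_smul]

theorem opposite_mem {x : ℝ} (h0 : 0 ≤ x) (h1 : x ≤ R.a) :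
    (-x) • dir 0 ∈ segment ℝ 0 (R.s 1) := by
  rw [segment_eq_image]
  have := R.a_pos
  refine ⟨x / R.a, ⟨by positivity, div_le_one_of_le₀ h1 this.le⟩, ?_⟩
  simp only [smul_zero, zero_add, R.s_one, smul_smul]
  congr 1
  field_simp

theorem reflection_mem {x : ℝ} (h0 : 0 ≤ x) (h1 : x ≤ I.r) :
    x • dir θ ∈ segment ℝ 0 I.reflectionPoint := by
  rw [segment_eq_image]
  have := I.r_pos
  refine ⟨x / I.r, ⟨by positivity, div_le_one_of_le₀ h1 this.le⟩, ?_⟩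
  simp only [smul_zero, zero_add, reflectionPoint, smul_smul]
  congr 1
  field_simp

theorem mem_closure_of_wall {ξ : Plane} (h : ξ ∈ segment ℝ 0 I.reflectionPoint ∨
    ξ ∈ segment ℝ 0 (R.s 1)) : ξ ∈ closure R.Ω :=
  frontier_subset_closure (by
    rw [R.Ω_frontier]
    rcases h with h | h
    · exact Or.inl (Or.inr h)
    · exact Or.inr h)

theorem inner_dir_wallNormal (θ x : ℝ) : inner ℝ (x • dir θ) (reflectionWallNormal θ) = 0 := by
  rw [inner_eq]
  simp only [PiLp.smul_apply, dir_zero, dir_one, smul_eq_mul, reflectionWallNormal_zero,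
    reflectionWallNormal_one]
  ring

theorem wall_notMem {ξ : Plane} (h : ξ ∈ segment ℝ 0 I.reflectionPoint ∨
    ξ ∈ segment ℝ 0 (R.s 1)) : ξ ∉ fluidDomain θ := by
  rintro ⟨h1, h2⟩
  rcases h with h | h
  · obtain ⟨x, -, -, rfl⟩ := wall_reflection h
    rw [inner_dir_wallNormal] at h2
    exact lt_irrefl _ h2
  · obtain ⟨x, -, -, -, h⟩ := R.wall_opposite h
    exact h1.ne' h

/-- Inside the open sector the frontier of `R.Ω` consists of shock points only. A ball that avoids
the shock meets the sector in a convex set, and connectedness puts all of it into `R.Ω`. -/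
theorem exists_ball {p : Plane} (hp : p ∈ closure R.Ω) (hpS : p ∉ R.shockCurve) :
    ∃ ε > 0, fluidDomain θ ∩ Metric.ball p ε ⊆ R.Ω := by
  obtain ⟨ε, hε, hsub⟩ := Metric.isOpen_iff.1 R.isCompact_shockCurve.isClosed.isOpen_compl p hpS
  refine ⟨ε, hε, ?_⟩
  refine IsPreconnected.subset_left_of_subset_union R.Ω_open isClosed_closure.isOpen_compl
    (disjoint_compl_right.mono_left subset_closure) (fun ξ hξ => ?_) ?_
    ((convex_fluidDomain θ).inter (convex_ball p ε)).isPreconnected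
  · by_cases h : ξ ∈ closure R.Ω
    · left
      by_contra hn
      have hf : ξ ∈ frontier R.Ω := ⟨h, by rwa [R.Ω_open.interior_eq]⟩
      rw [R.Ω_frontier] at hf
      rcases hf with (hf | hf) | hf
      · exact hsub hξ.2 hf
      · exact R.wall_notMem (Or.inl hf) hξ.1
      · exact R.wall_notMem (Or.inr hf) hξ.1
    · exact Or.inr h
  · obtain ⟨ξ, h1, h2⟩ := mem_closure_iff.1 hp _ Metric.isOpen_ball (Metric.mem_ball_self hε)
    exact ⟨ξ, ⟨R.Ω_sub h2, h1⟩, h2⟩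

theorem eventually_mem_closure {p : Plane} (hp : p ∈ closure R.Ω) (hpS : p ∉ R.shockCurve) :
    ∀ᶠ η in 𝓝[closure (fluidDomain θ)] p, η ∈ closure R.Ω := by
  obtain ⟨ε, hε, hsub⟩ := R.exists_ball hp hpS
  filter_upwards [inter_mem_nhdsWithin (closure (fluidDomain θ)) (Metric.ball_mem_nhds p hε)]
    with η hη
  exact closure_mono hsub (Metric.isOpen_ball.closure_inter hη)

/-- Away from the shock the potential is differentiable up to the walls. -/
theorem hasFDerivWithinAt_ψ {p : Plane} (hp : p ∈ closure R.Ω) (hpS : p ∉ R.shockCurve) :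
    HasFDerivWithinAt R.ψ (InnerProductSpace.toDual ℝ Plane (R.v p))
      (closure (fluidDomain θ)) p := by
  obtain ⟨ε, hε, hsub⟩ := R.exists_ball hp hpS
  have hcl := closure_mono hsub
  have h := hasFDerivWithinAt_closure_of_tendsto_fderiv (f := R.ψ)
    (s := fluidDomain θ ∩ Metric.ball p ε) (x := p)
    (f' := InnerProductSpace.toDual ℝ Plane (R.v p))
    (fun ξ hξ => (R.ψ_grad ξ (hsub hξ)).differentiableAt.differentiableWithinAt)
    ((convex_fluidDomain θ).inter (convex_ball p ε))
    ((isOpen_fluidDomain θ).inter Metric.isOpen_ball)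
    (fun ξ hξ => (R.ψ_cont ξ (hcl hξ)).mono (hsub.trans subset_closure)) (by
      have h1 : Tendsto (fun ξ => InnerProductSpace.toDual ℝ Plane (R.v ξ))
          (𝓝[fluidDomain θ ∩ Metric.ball p ε] p)
          (𝓝 (InnerProductSpace.toDual ℝ Plane (R.v p))) :=
        ((InnerProductSpace.toDual ℝ Plane).continuous.tendsto _).comp
          ((R.v_cont p hp).mono (hsub.trans subset_closure))
      refine h1.congr' ?_
      filter_upwards [self_mem_nhdsWithin] with ξ hξ
      exact (R.ψ_grad ξ (hsub hξ)).hasFDerivAt.fderiv.symm)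
  refine h.mono_of_mem_nhdsWithin ?_
  filter_upwards [inter_mem_nhdsWithin (closure (fluidDomain θ)) (Metric.ball_mem_nhds p hε)]
    with η hη
  exact Metric.isOpen_ball.closure_inter hη

/-- First-order condition at a maximum of `ψ - w · ξ` away from the shock. -/
theorem inner_nonpos_of_max {p w q : Plane} (hp : p ∈ closure R.Ω) (hpS : p ∉ R.shockCurve)
    (hmax : ∀ ξ ∈ closure R.Ω, R.ψ ξ - inner ℝ w ξ ≤ R.ψ p - inner ℝ w p)
    (hpq : p + q ∈ closure (fluidDomain θ)) : inner ℝ (R.v p - w) q ≤ 0 := by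
  have h1 : IsLocalMaxOn (fun ξ => R.ψ ξ - inner ℝ w ξ) (closure (fluidDomain θ)) p := by
    filter_upwards [R.eventually_mem_closure hp hpS] with ξ hξ using hmax ξ hξ
  have h2 := h1.hasFDerivWithinAt_nonpos ((R.hasFDerivWithinAt_ψ hp hpS).sub
    (InnerProductSpace.toDual ℝ Plane w).hasFDerivAt.hasFDerivWithinAt)
    (mem_posTangentConeAt_of_segment_subset
      ((convex_fluidDomain θ).closure.segment_subset (closure_mono R.Ω_sub hp) hpq))
  simpa [inner_sub_left] using h2

theorem isCompact_closure_Ω : IsCompact (closure R.Ω) := R.Ω_bdd.isCompact_closure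

/-- The slip condition makes the normal derivative of `ψ` vanish on the walls. Adding a small linear
function that increases into the sector makes the inward derivative strictly positive, which
excludes maxima on the walls away from the shock. -/
theorem exists_max_perturbed (hθ : θ ∈ Ioo 0 Real.pi) (hc : Real.cos θ < 0) {δ : ℝ} (hδ : 0 < δ) :
    ∃ t ∈ Icc (0 : ℝ) 1, ∀ ξ ∈ closure R.Ω,
      R.ψ ξ + δ * inner ℝ (dir ((θ + Real.pi) / 2)) ξ ≤
        R.ψ (R.s t) + δ * inner ℝ (dir ((θ + Real.pi) / 2)) (R.s t) := by
  obtain ⟨d1, d2⟩ := dir_mem_fluidDomain hθ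
  have hs : 0 < Real.sin θ := Real.sin_pos_of_mem_Ioo hθ
  have hc' := hc.ne
  set d := dir ((θ + Real.pi) / 2) with hd
  set w : Plane := -(δ • d) with hw
  have hwe : ∀ ξ : Plane, R.ψ ξ + δ * inner ℝ d ξ = R.ψ ξ - inner ℝ w ξ := fun ξ => by
    rw [hw, inner_neg_left, real_inner_smul_left]; ring
  simp_rw [hwe]
  have hcont : ContinuousOn (fun ξ => R.ψ ξ - inner ℝ w ξ) (closure R.Ω) :=
    R.ψ_cont.sub (by fun_prop)
  obtain ⟨p, hp, hpmax⟩ := R.isCompact_closure_Ω.exists_isMaxOn R.Ω_conn.nonempty.closure hcont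
  obtain ⟨p, hp, hpmax⟩ : ∃ p ∈ frontier R.Ω, ∀ ξ ∈ closure R.Ω,
      R.ψ ξ - inner ℝ w ξ ≤ R.ψ p - inner ℝ w p := by
    by_cases hpΩ : p ∈ R.Ω
    · obtain ⟨q, hq, he⟩ := G.exists_frontier_ge R.Ω_open R.Ω_bdd R.ψ_cont R.v_cont R.ρ_cont
        R.ψ_grad R.ρ_pos R.bernoulli R.weak_eq R.elliptic w hpΩ fun ξ hξ => hpmax hξ
      exact ⟨q, hq, fun ξ hξ => he ▸ hpmax hξ⟩
    · exact ⟨p, ⟨hp, by rwa [R.Ω_open.interior_eq]⟩, fun ξ hξ => hpmax hξ⟩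
  suffices hS : p ∈ R.shockCurve by
    obtain ⟨t, ht, rfl⟩ := hS
    exact ⟨t, ht, hpmax⟩
  by_contra hpS
  have hpc := frontier_subset_closure hp
  rw [R.Ω_frontier] at hp
  have first : ∀ q, p + q ∈ closure (fluidDomain θ) → inner ℝ (R.v p - w) q ≤ 0 := fun q hq =>
    R.inner_nonpos_of_max hpc hpS hpmax hq
  have hw1 : w 1 < 0 := by
    have := mul_pos hδ d1
    simp only [hw, PiLp.neg_apply, PiLp.smul_apply, smul_eq_mul]
    linarith
  have hwn : 0 < inner ℝ w (reflectionWallNormal θ) := by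
    rw [hw, inner_neg_left, real_inner_smul_left]
    have := mul_neg_of_pos_of_neg hδ d2
    linarith
  have corner : p ≠ 0 := by
    rintro rfl
    have v1 := R.slip_opposite 0 (left_mem_segment ℝ _ _)
    have v2 := R.slip_reflection 0 (left_mem_segment ℝ _ _)
    -- Two independent slip conditions stop the fluid at the corner, leaving only the perturbation,
    -- which increases into the sector.
    have v0 : R.v 0 = 0 := by
      rw [inner_eq, v1, reflectionWallNormal_zero, zero_mul, add_zero] at v2
      exact plane_ext ((mul_eq_zero.1 v2).resolve_right hs.ne') v1
    have := first (-w) (mem_closure_fluidDomain hθ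
      (by simp only [zero_add, PiLp.neg_apply]; linarith)
      (by rw [zero_add, inner_neg_left]; linarith))
    rw [v0, zero_sub, real_inner_self_eq_norm_sq] at this
    have h0 : -w = 0 := norm_eq_zero.1 (pow_eq_zero_iff two_ne_zero |>.1
      (le_antisymm this (sq_nonneg _)))
    rw [neg_eq_zero.1 h0] at hw1
    simp at hw1
  rcases hp with (hp | hp) | hp
  · exact hpS hp
  · have hv := R.slip_reflection p hp
    obtain ⟨x, hx0, -, hx⟩ := wall_reflection hp
    have hx0 : 0 < x := hx0.lt_of_ne fun h => corner (by rw [hx, ← h, zero_smul])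
    -- Since `cos θ < 0` the sector is acute, and the inward normal from the wall meets the other
    -- wall at this distance; this gives a test point in the closed sector.
    have hτ : 0 < x * Real.sin θ / -Real.cos θ := div_pos (mul_pos hx0 hs) (by linarith)
    have := first (-(x * Real.sin θ / -Real.cos θ) • reflectionWallNormal θ)
      (mem_closure_fluidDomain hθ (le_of_eq ?_) ?_)
    · rw [real_inner_smul_right, inner_sub_left, hv] at this
      nlinarith
    · rw [hx]
      simp only [PiLp.add_apply, PiLp.smul_apply, dir_one, smul_eq_mul, reflectionWallNormal_one]
      field_simp
      ring
    · rw [hx, inner_add_left, inner_dir_wallNormal, real_inner_smul_left, zero_add]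
      have := real_inner_self_nonneg (x := reflectionWallNormal θ)
      nlinarith
  · have hv := R.slip_opposite p hp
    obtain ⟨x, hx0, -, hx, hx1⟩ := R.wall_opposite hp
    have hx0 : 0 < x := hx0.lt_of_ne fun h => corner (plane_ext (by rw [hx, ← h]; simp)
      (by rw [hx1]; simp))
    have hτ : 0 < x * Real.sin θ / -Real.cos θ := div_pos (mul_pos hx0 hs) (by linarith)
    have := first ((x * Real.sin θ / -Real.cos θ) • dir (Real.pi / 2))
      (mem_closure_fluidDomain hθ ?_ (le_of_eq ?_))
    · simp only [inner_eq, PiLp.sub_apply, PiLp.smul_apply, dir_zero, dir_one,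
        Real.cos_pi_div_two, Real.sin_pi_div_two, smul_eq_mul, mul_zero, mul_one, hv] at this
      nlinarith
    · simp only [PiLp.add_apply, PiLp.smul_apply, dir_one, Real.sin_pi_div_two, smul_eq_mul,
        mul_one, hx1]
      linarith
    · simp only [inner_eq, PiLp.add_apply, PiLp.smul_apply, dir_zero, dir_one,
        Real.cos_pi_div_two, Real.sin_pi_div_two, smul_eq_mul, mul_zero, mul_one, hx, hx1,
        reflectionWallNormal_zero, reflectionWallNormal_one]
      field_simp
      ring

/-- The potential in the 3-sector is maximal at a point of the reflected shock. -/
theorem exists_max (hθ : θ ∈ Ioo 0 Real.pi) (hc : Real.cos θ < 0) :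
    ∃ t ∈ Icc (0 : ℝ) 1, ∀ ξ ∈ closure R.Ω, R.ψ ξ ≤ R.ψ (R.s t) := by
  obtain ⟨p, hp, hpmax⟩ := R.isCompact_shockCurve.exists_isMaxOn
    ⟨_, mem_image_of_mem _ (left_mem_Icc.2 zero_le_one)⟩ (R.ψ_cont.mono R.shockCurve_subset)
  obtain ⟨t, ht, rfl⟩ := hp
  refine ⟨t, ht, fun ξ hξ => ?_⟩
  set d := dir ((θ + Real.pi) / 2) with hd
  obtain ⟨B, hB⟩ := R.isCompact_closure_Ω.exists_bound_of_continuousOn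
    (f := fun ξ => inner ℝ d ξ) (by fun_prop)
  have hlim : Tendsto (fun δ : ℝ => R.ψ (R.s t) + δ * (2 * B)) (𝓝[>] 0) (𝓝 (R.ψ (R.s t))) := by
    have : Continuous fun δ : ℝ => R.ψ (R.s t) + δ * (2 * B) := by fun_prop
    simpa using (this.tendsto 0).mono_left nhdsWithin_le_nhds
  refine ge_of_tendsto hlim ?_
  filter_upwards [self_mem_nhdsWithin] with δ (hδ : 0 < δ)
  obtain ⟨t', ht', h⟩ := R.exists_max_perturbed hθ hc hδ
  have h1 := h ξ hξ
  have hm := mem_image_of_mem R.s ht'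
  have h2 : R.ψ (R.s t') ≤ R.ψ (R.s t) := hpmax hm
  have h3 := abs_le.1 (hB _ (R.shockCurve_subset hm))
  have h4 := abs_le.1 (hB ξ hξ)
  rw [← hd] at h1
  have h5 : δ * (inner ℝ d (R.s t') - inner ℝ d ξ) ≤ δ * (2 * B) := by
    gcongr; linarith
  linarith

/-- At shock points `ψ` is controlled only along particular rays. The limit of the derivatives along
such a ray, supplied by continuity of `R.v`, is the one-sided derivative at the maximum. -/
theorem inner_nonpos_of_max_of_line {p d : Plane} (hp : p ∈ closure R.Ω)
    (hmax : ∀ ξ ∈ closure R.Ω, R.ψ ξ ≤ R.ψ p)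
    (hd : ∀ᶠ τ in 𝓝[>] (0 : ℝ), p + τ • d ∈ closure R.Ω ∧
      HasDerivAt (fun τ => R.ψ (p + τ • d)) (inner ℝ (R.v (p + τ • d)) d) τ) :
    inner ℝ (R.v p) d ≤ 0 := by
  have hline : Tendsto (fun τ : ℝ => p + τ • d) (𝓝[>] 0) (𝓝[closure R.Ω] p) := by
    refine tendsto_nhdsWithin_iff.2 ⟨?_, hd.mono fun τ h => h.1⟩
    have : Continuous fun τ : ℝ => p + τ • d := by fun_prop
    simpa using (this.tendsto 0).mono_left nhdsWithin_le_nhds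
  refine deriv_nonpos_of_max (f := fun τ => R.ψ (p + τ • d))
    (f' := fun τ => inner ℝ (R.v (p + τ • d)) d) ?_ (hd.mono fun τ h => h.2)
    (((R.v_cont p hp).tendsto.comp hline).inner tendsto_const_nhds)
    (hd.mono fun τ h => by simpa using hmax _ h.1)
  have := (R.ψ_cont p hp).tendsto.comp hline
  simpa [ContinuousWithinAt, Function.comp_def] using this

theorem hasDerivAt_line_of_wall {p d : Plane} {τ : ℝ} (hp : p + τ • d ∈ closure R.Ω)
    (hpS : p + τ • d ∉ R.shockCurve)
    (hd : ∀ᶠ σ in 𝓝 τ, p + σ • d ∈ closure (fluidDomain θ)) :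
    HasDerivAt (fun τ => R.ψ (p + τ • d)) (inner ℝ (R.v (p + τ • d)) d) τ := by
  have h1 : HasDerivAt (fun τ : ℝ => p + τ • d) d τ := by
    simpa using ((hasDerivAt_id τ).smul_const d).const_add p
  have h2 := (R.hasFDerivWithinAt_ψ hp hpS).comp_hasDerivWithinAt τ
    (h1.hasDerivWithinAt (s := {σ | p + σ • d ∈ closure (fluidDomain θ)})) (fun σ hσ => hσ)
  exact (h2.hasDerivAt hd).congr_deriv (by simp)

theorem s_endpoint {t : ℝ} (ht : t ∈ Icc (0 : ℝ) 1) (h : R.s t ∉ fluidDomain θ) :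
    t = 0 ∨ t = 1 := by
  by_contra! hn
  exact h (R.s_mem t ⟨ht.1.lt_of_ne hn.1.symm, ht.2.lt_of_ne hn.2⟩).1

/-- The reflection wall itself is a ray in the closed 3-sector along which `ψ` starts to increase.
-/
theorem not_max_reflectionPoint (hθ : θ ∈ Ioo 0 Real.pi)
    (hv : 0 < inner ℝ (R.v I.reflectionPoint) (-dir θ)) :
    ¬ ∀ ξ ∈ closure R.Ω, R.ψ ξ ≤ R.ψ I.reflectionPoint := fun hmax => by
  have hs : 0 < Real.sin θ := Real.sin_pos_of_mem_Ioo hθ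
  have hr := I.r_pos
  refine hv.not_ge (R.inner_nonpos_of_max_of_line
    (R.mem_closure_of_wall (Or.inl (right_mem_segment ℝ _ _))) hmax ?_)
  filter_upwards [Ioo_mem_nhdsGT hr] with τ hτ
  have e : ∀ σ : ℝ, I.reflectionPoint + σ • -dir θ = (I.r - σ) • dir θ := fun σ => by
    rw [reflectionPoint, sub_smul, smul_neg, sub_eq_add_neg]
  have hw := reflection_mem (I := I) (x := I.r - τ) (by linarith [hτ.2]) (by linarith [hτ.1])
  have hm : I.reflectionPoint + τ • -dir θ ∈ closure R.Ω := by
    rw [e]; exact R.mem_closure_of_wall (Or.inl hw)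
  refine ⟨hm, R.hasDerivAt_line_of_wall hm ?_ ?_⟩
  · rw [e]
    rintro ⟨t, ht, h⟩
    have h1 : (I.r - τ) * Real.sin θ = R.s t 1 := by rw [h]; rfl
    rcases R.s_endpoint ht (by rw [h]; exact R.wall_notMem (Or.inl hw)) with rfl | rfl
    · rw [R.s_zero, reflectionPoint_one] at h1
      have := mul_pos hτ.1 hs
      linarith
    · have : R.s 1 1 = 0 := by rw [R.s_one]; simp
      rw [this] at h1
      exact (mul_pos (sub_pos.2 hτ.2) hs).ne' h1
  · filter_upwards [gt_mem_nhds hτ.2] with σ hσ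
    rw [e]
    refine mem_closure_fluidDomain hθ ?_ (inner_dir_wallNormal _ _).le
    exact mul_nonneg (sub_nonneg.2 hσ.le) hs.le

/-- `R.Ω_side` covers only interior parameters, so at the endpoint the ray runs along the opposite
wall towards the corner. -/
theorem v_nonpos_of_max_endpoint (hθ : θ ∈ Ioo 0 Real.pi)
    (hmax : ∀ ξ ∈ closure R.Ω, R.ψ ξ ≤ R.ψ (R.s 1)) : R.v (R.s 1) 0 ≤ 0 := by
  have hs : 0 < Real.sin θ := Real.sin_pos_of_mem_Ioo hθ
  have ha := R.a_pos
  have := R.inner_nonpos_of_max_of_line (d := dir 0)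
    (R.mem_closure_of_wall (Or.inr (right_mem_segment ℝ _ _))) hmax ?_
  · simpa [inner_eq] using this
  filter_upwards [Ioo_mem_nhdsGT ha] with τ hτ
  have e : ∀ σ : ℝ, R.s 1 + σ • dir 0 = (-(R.a - σ)) • dir 0 := fun σ => by
    rw [R.s_one, ← add_smul]; congr 1; ring
  have hw := R.opposite_mem (x := R.a - τ) (by linarith [hτ.2]) (by linarith [hτ.1])
  have hm : R.s 1 + τ • dir 0 ∈ closure R.Ω := by
    rw [e]; exact R.mem_closure_of_wall (Or.inr hw)
  refine ⟨hm, R.hasDerivAt_line_of_wall hm ?_ ?_⟩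
  · rw [e]
    rintro ⟨t, ht, h⟩
    rcases R.s_endpoint ht (by rw [h]; exact R.wall_notMem (Or.inr hw)) with rfl | rfl
    · have h1 : R.s 0 1 = 0 := by rw [h]; simp
      rw [R.s_zero, reflectionPoint_one] at h1
      exact (mul_pos I.r_pos hs).ne' h1
    · have h1 : R.s 1 0 = -(R.a - τ) := by rw [h]; simp
      have h2 : R.s 1 0 = -R.a := by rw [R.s_one]; simp
      linarith [hτ.1]
  · filter_upwards [gt_mem_nhds hτ.2] with σ hσ
    rw [e]
    refine mem_closure_fluidDomain hθ (by simp) ?_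
    rw [inner_eq]
    simp only [PiLp.smul_apply, dir_zero, dir_one, Real.cos_zero, Real.sin_zero, smul_eq_mul,
      mul_zero, zero_mul, mul_one, add_zero, reflectionWallNormal_zero]
    nlinarith [mul_nonneg (sub_nonneg.2 hσ.le) hs.le]

theorem inner_normal_nonpos_of_max {t : ℝ} (ht : t ∈ Ioo (0 : ℝ) 1)
    (hmax : ∀ ξ ∈ closure R.Ω, R.ψ ξ ≤ R.ψ (R.s t)) :
    inner ℝ (R.v (R.s t)) (rot90 (R.s' t)) ≤ 0 := by
  refine R.inner_nonpos_of_max_of_line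
    (R.shockCurve_subset (mem_image_of_mem _ (Ioo_subset_Icc_self ht))) hmax ?_
  filter_upwards [R.Ω_side t ht] with τ hτ
  refine ⟨subset_closure hτ.1, ?_⟩
  have h1 : HasDerivAt (fun τ : ℝ => R.s t + τ • rot90 (R.s' t)) (rot90 (R.s' t)) τ := by
    simpa using ((hasDerivAt_id τ).smul_const (rot90 (R.s' t))).const_add (R.s t)
  exact ((R.ψ_grad _ hτ.1).hasFDerivAt.comp_hasDerivAt τ h1).congr_deriv (by simp)

/-- As `v₂` is horizontal, for `0 < I.v₂ 0` maximizing `ψ` on the shock means maximizing the first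
coordinate. -/
theorem ψ_s {t : ℝ} (ht : t ∈ Icc (0 : ℝ) 1) :
    R.ψ (R.s t) = I.v₂ 0 * R.s t 0 - ‖I.v₂‖ ^ 2 / 2 - G.enthalpy I.ρ₂ := by
  rw [R.ψ_shock t ht, Gas.constPotential, inner_eq, I.slip]
  ring

/-- At an interior maximum of the potential along the shock the shock is vertical. -/
theorem tangent_zero_of_max (hu : 0 < I.v₂ 0) {t : ℝ} (ht : t ∈ Ioo (0 : ℝ) 1)
    (hmax : ∀ ξ ∈ closure R.Ω, R.ψ ξ ≤ R.ψ (R.s t)) : R.s' t 0 = 0 := by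
  have hI := Ioo_subset_Icc_self ht
  have hnhds := Icc_mem_nhds ht.1 ht.2
  have hd : HasDerivAt (fun t => R.s t 0) (R.s' t 0) t :=
    (EuclideanSpace.proj (0 : Fin 2) : Plane →L[ℝ] ℝ).hasFDerivAt.comp_hasDerivAt t
      ((R.s_deriv t hI).hasDerivAt hnhds)
  have hloc : IsLocalMax (fun t => R.s t 0) t := by
    filter_upwards [hnhds] with τ hτ
    have := hmax _ (R.shockCurve_subset (mem_image_of_mem _ hτ))
    rw [R.ψ_s hτ, R.ψ_s hI] at this
    exact le_of_mul_le_mul_left (by linarith) hu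
  exact hloc.hasDerivAt_eq_zero hd

end Incident.GlobalRR

/-- A vertical shock at `-P` with nonpositive downstream velocity, in a flow with velocity `u`
towards the right, excludes that the mass flux of stagnant fluid at `-X` is too small. -/
theorem Gas.stagnation_flux_le (G : Gas) {ρ₂ ρd u P X z : ℝ} (hρ₂ : 0 < ρ₂) (hρd : 0 < ρd)
    (hu : 0 < u) (hP : 0 < P) (hPX : P ≤ X) (hz : z ≤ P)
    (hmass : ρ₂ * (u + P) = ρd * z)
    (hbern : G.enthalpy ρ₂ + (u + P) ^ 2 / 2 = G.enthalpy ρd + z ^ 2 / 2) :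
    ρ₂ * (u + X) ≤ G.density (G.enthalpy ρ₂ + u ^ 2 / 2 + u * X) * X := by
  set A := G.enthalpy ρ₂ + (u + P) ^ 2 / 2 with hA
  have hz0 : 0 < z := by
    have : 0 < ρd * z := by rw [← hmass]; positivity
    exact (pos_iff_pos_of_mul_pos this).1 hρd
  have e1 : A - (u + P) ^ 2 / 2 = G.enthalpy ρ₂ := by rw [hA]; ring
  have e2 : A - z ^ 2 / 2 = G.enthalpy ρd := by rw [hbern]; ring
  have e3 : A - P ^ 2 / 2 = G.enthalpy ρ₂ + u ^ 2 / 2 + u * P := by rw [hA]; ring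
  have hs : u + P ∈ G.speeds A := ⟨by linarith, by rw [e1]; exact G.base_enthalpy_pos hρ₂⟩
  have h := G.flux_le hz0 hz (by linarith : P < u + P) hs
    (by rw [e1, e2, G.density_enthalpy hρ₂, G.density_enthalpy hρd, hmass])
  rw [e1, e3, G.density_enthalpy hρ₂] at h
  have hmono : G.density (G.enthalpy ρ₂ + u ^ 2 / 2 + u * P) ≤
      G.density (G.enthalpy ρ₂ + u ^ 2 / 2 + u * X) := by
    refine G.density_le_density ?_ (by gcongr)
    rw [← e3]
    exact (G.speeds_ordConnected_left hs hP (by linarith)).2.le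
  have hX : 0 < X := hP.trans_le hPX
  set D := G.density (G.enthalpy ρ₂ + u ^ 2 / 2 + u * P)
  set D' := G.density (G.enthalpy ρ₂ + u ^ 2 / 2 + u * X)
  have i1 : ρ₂ * (u + P) * X ≤ D * P * X := by gcongr
  have i2 : D * (P * X) ≤ D' * (P * X) := by gcongr
  have i3 : ρ₂ * (u * P) ≤ ρ₂ * (u * X) := by gcongr
  refine le_of_mul_le_mul_right ?_ hP
  linarith

end RegularReflection

end

/-! ### The contradiction at the rightmost shock point -/

theorem theorem1 (G : RegularReflection.Gas) (ρ₁ M₁ α θ : ℝ) (hρ₁ : 0 < ρ₁)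
    (hθ : θ ∈ Set.Ioo 0 Real.pi) (hα : α + θ ∈ Set.Ioo 0 Real.pi)
    (I : RegularReflection.Incident G ρ₁ M₁ α θ)
    (hweak : I.HasTransonicWeakRR) (hangle : ¬ I.AngleCondition) :
    IsEmpty I.GlobalRR := by
  refine ⟨fun R => ?_⟩
  have hs : 0 < Real.sin θ := Real.sin_pos_of_mem_Ioo hθ
  obtain ⟨hu, hc, hlt, hRR⟩ := I.of_not_angleCondition hθ hα hangle
  have h0 : (0 : ℝ) ∈ Set.Icc (0 : ℝ) 1 := Set.left_mem_Icc.2 zero_le_one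
  have hcl : ∀ {t}, t ∈ Set.Icc (0 : ℝ) 1 → R.s t ∈ closure R.Ω := fun ht =>
    R.shockCurve_subset (Set.mem_image_of_mem _ ht)
  have hv : 0 < inner ℝ (R.v I.reflectionPoint) (-RegularReflection.dir θ) := by
    have h1 := R.shock 0 h0
    have h2 := R.ρ_pos _ (hcl h0)
    rw [R.s_zero] at h1 h2
    exact hRR _ _ _ h2 (R.slip_reflection _ (right_mem_segment ℝ _ _)) h1
  obtain ⟨t, ht, hmax⟩ := R.exists_max hθ hc
  have ht0 : t ≠ 0 := by
    rintro rfl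
    rw [R.s_zero] at hmax
    exact R.not_max_reflectionPoint hθ hv hmax
  have hx : R.s t 0 < 0 := by
    rcases ht.2.eq_or_lt with rfl | h1
    · have : R.s 1 0 = -R.a := by rw [R.s_one]; simp
      linarith [R.a_pos]
    · obtain ⟨⟨p1, p2⟩, -⟩ := R.s_mem t ⟨ht.1.lt_of_ne ht0.symm, h1⟩
      rw [RegularReflection.inner_eq, RegularReflection.reflectionWallNormal_zero,
        RegularReflection.reflectionWallNormal_one] at p2
      nlinarith [mul_pos p1 (neg_pos.2 hc)]
  have htan : R.s' t 0 = 0 := by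
    rcases ht.2.eq_or_lt with rfl | h1
    · simpa [RegularReflection.inner_eq] using R.right_angle
    · exact R.tangent_zero_of_max hu ⟨ht.1.lt_of_ne ht0.symm, h1⟩ hmax
  have hsh := R.shock t ht
  have hpos := hsh.normal_pos
  have hm := hsh.mass
  have htg := hsh.tangential
  have hb := hsh.bernoulli
  simp only [RegularReflection.inner_eq, RegularReflection.norm_sq_eq, PiLp.sub_apply,
    RegularReflection.rot90_zero, RegularReflection.rot90_one, htan, mul_zero, add_zero, neg_zero,
    zero_add] at hpos hm htg hb
  -- The upstream flow relative to this point moves to the right, so the downstream side of the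
  -- vertical shock is its right side.
  have hn : 0 < -R.s' t 1 := (pos_iff_pos_of_mul_pos hpos).1 (by linarith)
  have hvt : R.v (R.s t) 0 ≤ 0 := by
    rcases ht.2.eq_or_lt with rfl | h1
    · exact R.v_nonpos_of_max_endpoint hθ hmax
    · have h2 := R.inner_normal_nonpos_of_max ⟨ht.1.lt_of_ne ht0.symm, h1⟩ hmax
      simp only [RegularReflection.inner_eq, RegularReflection.rot90_zero,
        RegularReflection.rot90_one, htan, mul_zero, add_zero] at h2
      by_contra! h3
      exact h2.not_gt (mul_pos h3 hn)
  -- Maximality compared with the reflection point, which is itself on the shock curve.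
  have hPX : -R.s t 0 ≤ -(I.r * Real.cos θ) := by
    have := hmax _ (hcl h0)
    rw [R.ψ_s h0, R.ψ_s ht, R.s_zero, I.reflectionPoint_zero] at this
    have h3 : I.v₂ 0 * (I.r * Real.cos θ) ≤ I.v₂ 0 * R.s t 0 := by linarith
    linarith [le_of_mul_le_mul_left h3 hu]
  have htg' := mul_right_cancel₀ hn.ne' htg
  refine hlt.not_ge (G.stagnation_flux_le I.ρ₂_pos (R.ρ_pos _ (hcl ht)) hu (neg_pos.2 hx) hPX
    (z := R.v (R.s t) 0 - R.s t 0) (by linarith) ?_ ?_)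
  · refine mul_right_cancel₀ hn.ne' ?_
    linarith
  · rw [htg'] at hb
    rw [← sub_eq_add_neg]
    linarith
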